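/- Let $\rho$ and $\theta$ be Hermitian $N\times N$ complex matrices. Let $\lambda_1>\dots>\lambda_r$ be the distinct eigenvalues of $\rho$, with multiplicities $n_1,\dots,n_r$, and let $\varepsilon_1>\dots>\varepsilon_s$ be the distinct eigenvalues of $\theta$, with multiplicities $m_1,\dots,m_s$. Write $\rho=R\tilde\rho R^\dagger$ and $\theta=S\tilde\theta S^\dagger$ with $R,S$ unitary and $\tilde\rho,\tilde\theta$ diagonal. Let $J(U)=\operatorname{tr}(U\rho U^\dagger\theta)$ on the unitary group $\mathcal U(N)$; a point $U$ is critical if $\frac{d}{dt}J(e^{itA}U)|_{t=0}=0$ for all Hermitian $A$. The critical submanifolds of $J$ are the connected components of its set of critical points. Let $\mathcal U(\mathbf n)=\prod_i\mathcal U(n_i)$ and $\mathcal U(\mathbf m)=\prod_j\mathcal U(m_j)$ be embedded in $\mathcal U(N)$ as the block-diagonal unitary matrices on the eigenspaces of $\tilde\rho$ and $\tilde\theta$ respectively. A contingency table is an $r\times s$ matrix $K=(k_{ij})$ of nonnegative integers with row sums $n_i$ and column sums $m_j$. The table of a permutation $\pi$ of $\{1,\dots,N\}$ has as its $(i,j)$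 entry the number of positions $x$ with $\tilde\rho_{xx}=\lambda_i$ and $\tilde\theta_{\pi(x)\pi(x)}=\varepsilon_j$; $\pi$ also denotes the permutation matrix sending the basis vector $e_x$ to $e_{\pi(x)}$. Then the critical submanifolds of $J$ are smooth embedded submanifolds, and they correspond one-to-one with the contingency tables, $K\mapsto\mathcal M_K$, as follows. Every table $K$ is the table of some permutation, and for every permutation $\pi$ with table $K$, $$\mathcal M_K=\{S\,P\pi Q\,R^\dagger : P\in\mathcal U(\mathbf m),\ Q\in\mathcal U(\mathbf n)\}.$$ Moreover $$\mathcal M_K\cong\frac{\mathcal U(\mathbf m)\times\mathcal U(\mathbf n)}{\mathcal U(K)},\qquad \mathcal U(K)=\prod_{k_{ij}\ne0}\mathcal U(k_{ij}),$$ where $\mathcal U(K)$ is embedded by $V\mapsto(\pi V\pi^\dagger,V)$, with $V$ acting block-diagonally, the factor $\mathcal U(k_{ij})$ acting on the coordinates $x$ with $\tilde\rho_{xx}=\lambda_i$ and $\tilde\theta_{\pi(x)\pi(x)}=\varepsilon_j$, and where the homeomorphism sends the class of $(P,Q)$ to $S\,P\pi Q^{\dagger}\,R^\dagger$. The value of $J$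 at every point of $\mathcal M_K$ is $J(K)=\sum_{i,j}k_{ij}\lambda_i\varepsilon_j$. -/

import Mathlib

open scoped ContDiff

namespace QuantumLandscape

noncomputable section

/-- The unitary group `U(N)`, with the topology of a subspace of the `N × N` complex matrices. -/
abbrev U (N : ℕ) : Type := Matrix.unitaryGroup (Fin N) ℂ

/-- The landscape `J(X) = tr (X ρ X† θ)`. On unitary `X` the trace is real when `ρ` and `θ` are
Hermitian, so taking the real part only fixes the codomain. -/
def landscape {N : ℕ} (ρ θ X : Matrix (Fin N) (Fin N) ℂ) : ℝ :=
  (X * ρ * X.conjTranspose * θ).trace.re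

/-- `V` is a critical point of `J` on `U(N)`: the derivative of `t ↦ J(exp(itA) V)` at `t = 0`
vanishes for every Hermitian `A`. -/
def IsCritical {N : ℕ} (ρ θ : Matrix (Fin N) (Fin N) ℂ) (V : U N) : Prop :=
  ∀ A : Matrix (Fin N) (Fin N) ℂ, A.IsHermitian →
    HasDerivAt (fun t : ℝ => landscape ρ θ
      (NormedSpace.exp ((Complex.I * (t : ℂ)) • A) * (V : Matrix (Fin N) (Fin N) ℂ))) 0 0

/-- The set of all critical points of `J` on `U(N)`. -/
def criticalSet {N : ℕ} (ρ θ : Matrix (Fin N) (Fin N) ℂ) : Set (U N) :=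
  {V | IsCritical ρ θ V}

/-- The (disjoint) critical submanifolds of `J`: the connected components of its critical set. -/
def criticalSubmanifolds {N : ℕ} (ρ θ : Matrix (Fin N) (Fin N) ℂ) : Set (Set (U N)) :=
  {M | ∃ V ∈ criticalSet ρ θ, M = connectedComponentIn (criticalSet ρ θ) V}

/-- A smooth embedded submanifold of a real normed space: near each of its points it is the zero
set of a smooth map to some `ℝᵏ` whose derivative at that point is onto. -/
def IsSmoothSubmanifold {E : Type*} [NormedAddCommGroup E] [NormedSpace ℝ E] (M : Set E) : Prop :=
  ∀ p ∈ M, ∃ W : Set E, IsOpen W ∧ p ∈ W ∧ ∃ (k : ℕ) (F : E → (Fin k → ℝ)),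
    ContDiffOn ℝ ∞ F W ∧ Function.Surjective (fderiv ℝ F p) ∧ M ∩ W = {q ∈ W | F q = 0}

/-- A subset of `U(N)` as a set of families of `N × N` complex matrix entries. -/
def entrySet {N : ℕ} (M : Set (U N)) : Set (Fin N → Fin N → ℂ) :=
  (fun (V : U N) (y x : Fin N) => (V : Matrix (Fin N) (Fin N) ℂ) y x) '' M

/-- The product group `U(n) = U(n₁) × ⋯ × U(n_r)`. -/
abbrev UProd {r : ℕ} (n : Fin r → ℕ) : Type := ∀ i : Fin r, U (n i)

/-- An `r × s` contingency table with row sums `nᵢ` and column sums `mⱼ`. -/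
structure ContingencyTable {r s : ℕ} (n : Fin r → ℕ) (m : Fin s → ℕ) where
  /-- the entries `kᵢⱼ` -/
  entry : Fin r → Fin s → ℕ
  row_sum : ∀ i, ∑ j, entry i j = n i
  col_sum : ∀ j, ∑ i, entry i j = m j

/-- The positions of the nonzero entries of a table. -/
abbrev ContingencyTable.Support {r s : ℕ} {n : Fin r → ℕ} {m : Fin s → ℕ}
    (K : ContingencyTable n m) : Type :=
  {p : Fin r × Fin s // K.entry p.1 p.2 ≠ 0}

/-- The group `U(K)`, the product of the `U(kᵢⱼ)` over the nonzero entries `kᵢⱼ` of `K`. -/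
abbrev ContingencyTable.UK {r s : ℕ} {n : Fin r → ℕ} {m : Fin s → ℕ}
    (K : ContingencyTable n m) : Type :=
  ∀ p : K.Support, U (K.entry p.1.1 p.1.2)

/-- The diagonal matrix in which the value `v i` stands at the `n i` positions that the labelling
`e` assigns to block `i`. -/
def blockScalar {N r : ℕ} {n : Fin r → ℕ} (e : (Σ i, Fin (n i)) ≃ Fin N) (v : Fin r → ℝ) :
    Matrix (Fin N) (Fin N) ℂ :=
  Matrix.diagonal fun x => (v (e.symm x).1 : ℂ)

/-- The block diagonal `N × N` matrix with the unitary blocks `P i`, where the positions of block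
`i` are given by the labelling `e`. -/
def blockMatrix {N : ℕ} {ι : Type*} [DecidableEq ι] {n : ι → ℕ} (e : (Σ i, Fin (n i)) ≃ Fin N)
    (P : ∀ i, U (n i)) : Matrix (Fin N) (Fin N) ℂ :=
  Matrix.reindex e e (Matrix.blockDiagonal' fun i => (P i : Matrix (Fin (n i)) (Fin (n i)) ℂ))

/-- The permutation matrix of `π`, which sends the basis vector `x` to the basis vector `π x`. -/
def permMat {N : ℕ} (π : Equiv.Perm (Fin N)) : Matrix (Fin N) (Fin N) ℂ :=
  Matrix.of fun y x => if y = π x then 1 else 0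

/-- The overlap number `kᵢⱼ` of `π`: the number of positions `x` of block `i` (of `ρ`) that `π`
sends to block `j` (of `θ`). -/
def overlap {N r s : ℕ} {n : Fin r → ℕ} {m : Fin s → ℕ} (e : (Σ i, Fin (n i)) ≃ Fin N)
    (e' : (Σ j, Fin (m j)) ≃ Fin N) (π : Equiv.Perm (Fin N)) (i : Fin r) (j : Fin s) : ℕ :=
  (Finset.univ.filter fun x : Fin N => (e.symm x).1 = i ∧ (e'.symm (π x)).1 = j).card

end

end QuantumLandscape

/-! Put M = VρV†. The derivative of J at V along A is the real part of i tr(A[M, θ]). Since C = [M,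
θ] is skew-Hermitian, A = iC is an admissible direction and gives tr(C†C). So V is critical iff M
commutes with θ (`isCritical_iff_commute`). With Y = S†VR this says that the spectral projections Y
Dᵢ Y† commute with the coordinate projections Eⱼ, which no longer involves the eigenvalues.

For such Y the products Y Dᵢ Y† Eⱼ are mutually orthogonal projections with sum 1. Their traces are
ranks, and these ranks form a contingency table (`IsAligned.exists_table`). Equal tables make two
such families unitarily equivalent, and the intertwiner splits into a factor of U(m) and a factor of
U(n) (`IsAligned.exists_eq_mul`). Hence the critical points with table K form one orbit of U(m) ×
U(n), through any permutation with table K (`stratum_eq_range`). The orbit is connected because U(N)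
is. The ranks are continuous and integral, so a component cannot meet two orbits. The stabilizer is
U(K) (`exists_stabilizer`), and compactness turns the orbit bijection into a homeomorphism.

For smoothness, a base point is moved to 1 by left and right multiplication. The full equations
[ZdZ†, ε] = 0 do not have independent differentials there: to first order they say nothing where d
has equal entries. Those equations are dropped. The rest, with Z†Z = 1, form a submersion onto a
real vector space (`exists_hasDerivAt_alignEq`), and near 1 they imply the dropped ones
(`exists_nhd_entries_eq_zero`). -/

namespace QuantumLandscape

noncomputable section

open scoped Matrix

/-! ### Compactness and connectedness of U(N) -/

section UnitaryTopology

open scoped Matrix.Norms.L2Operator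

instance instCompactSpaceUnitary (N : ℕ) : CompactSpace (U N) := by
  refine (isCompact_iff_compactSpace (s := {M | M ∈ Matrix.unitaryGroup (Fin N) ℂ})).mp ?_
  refine Metric.isCompact_of_isClosed_isBounded (isClosed_unitary) ?_
  refine (Metric.isBounded_closedBall (x := (0 : Matrix (Fin N) (Fin N) ℂ)) (r := 1)).subset ?_
  intro x hx
  simp only [Metric.mem_closedBall, dist_zero_right]
  cases subsingleton_or_nontrivial (Matrix (Fin N) (Fin N) ℂ)
  · rw [Subsingleton.elim x 0, norm_zero]; exact zero_le_one
  · exact (CStarRing.norm_of_mem_unitary hx).le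

/-- A finite set misses a point of the circle. For s a spectrum, the conclusion says that rotation
by `exp (i t)` moves no eigenvalue to -1. -/
lemma exists_circle_shift_notMem {s : Set ℂ} (hs : s.Finite) :
    ∃ t : ℝ, -Complex.exp (-(t * Complex.I)) ∉ s := by
  by_contra! h
  refine (Set.Ioc_infinite (show (0 : ℝ) < Real.pi by positivity)) ?_
  refine Set.Finite.of_finite_image (hs.subset (?_ :
    (fun t : ℝ => -Complex.exp (-(t * Complex.I))) '' _ ⊆ s)) ?_
  · rintro _ ⟨t, -, rfl⟩; exact h t
  · intro x hx y hy hxy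
    simp only [neg_inj] at hxy
    have h2 : Circle.exp x = Circle.exp y := by
      ext
      rw [Circle.coe_exp, Circle.coe_exp, ← inv_inj, ← Complex.exp_neg, ← Complex.exp_neg, hxy]
    exact Circle.injective_arg.eq_iff.mpr h2 |> fun h3 => by
      rwa [Circle.arg_exp (by linarith [hx.1, Real.pi_pos]) hx.2,
        Circle.arg_exp (by linarith [hy.1, Real.pi_pos]) hy.2] at h3

/-- The scalar unitary matrix `exp (i t)`. -/
def scalarUnitary (N : ℕ) (t : ℝ) : U N :=
  ⟨Complex.exp (t * Complex.I) • 1, by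
    rw [Matrix.mem_unitaryGroup_iff, star_smul, star_one, smul_mul_smul_comm, one_mul]
    have : Complex.exp (t * Complex.I) * star (Complex.exp (t * Complex.I)) = 1 := by
      rw [Complex.star_def, Complex.mul_conj, Complex.normSq_eq_norm_sq,
        Complex.norm_exp_ofReal_mul_I]
      norm_num
    rw [this, one_smul]⟩

/-- Choose a phase for which -1 is not an eigenvalue of `exp (i t) u`. Then u lies at distance less
than 2 from the scalar `exp (-i t)`, hence is joined to it, and the scalar is joined to 1 through
scalars. -/
lemma joined_one_unitary {N : ℕ} (u : U N) : Joined 1 u := by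
  obtain ⟨t, ht⟩ := exists_circle_shift_notMem
    (Matrix.finite_spectrum (R := ℂ) (u : Matrix (Fin N) (Fin N) ℂ))
  have h1 : Joined 1 (scalarUnitary N (-t)) := by
    have hc : Continuous (fun s : ℝ => scalarUnitary N s) := by
      refine Continuous.subtype_mk ?_ _
      fun_prop
    refine ⟨⟨⟨fun s => scalarUnitary N (-(s : ℝ) * t), by fun_prop⟩, ?_, ?_⟩⟩
    · ext; simp [scalarUnitary]
    · simp
  refine h1.trans (Unitary.joined (A := Matrix (Fin N) (Fin N) ℂ) _ _ ?_)
  have h2 : ((scalarUnitary N t * u : U N) : Matrix (Fin N) (Fin N) ℂ)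
      = Complex.exp (t * Complex.I) • (u : Matrix (Fin N) (Fin N) ℂ) := by
    simp [scalarUnitary]
  have h3 := (Unitary.norm_sub_one_lt_two_iff (A := Matrix (Fin N) (Fin N) ℂ)
    (scalarUnitary N t * u).2).2 ?_
  · rw [Unitary.norm_sub_eq]
    convert h3 using 4
    ext
    simp [scalarUnitary, ← Complex.exp_conj]
  · rw [h2]
    have hz : Complex.exp (t * Complex.I) ≠ 0 := Complex.exp_ne_zero _
    have h4 := spectrum.unit_smul_eq_smul (u : Matrix (Fin N) (Fin N) ℂ) (Units.mk0 _ hz)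
    intro h5
    have h6 := h4.subset h5
    obtain ⟨w, hw, hw'⟩ := h6
    refine ht ?_
    convert hw using 1
    replace hw' : Complex.exp (t * Complex.I) * w = -1 := hw'
    rw [Complex.exp_neg, ← mul_right_inj' hz, hw', mul_neg, mul_inv_cancel₀ hz]

instance instConnectedSpaceUnitary (N : ℕ) : ConnectedSpace (U N) :=
  haveI : PathConnectedSpace (U N) :=
    ⟨⟨1⟩, fun u v => (joined_one_unitary u).symm.trans (joined_one_unitary v)⟩
  inferInstance

end UnitaryTopology

lemma coe_mul_conjTranspose {N : ℕ} (V : U N) : V.1 * V.1ᴴ = 1 :=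
  Matrix.mem_unitaryGroup_iff.1 V.2

lemma conjTranspose_mul_coe {N : ℕ} (V : U N) : V.1ᴴ * V.1 = 1 :=
  Matrix.mem_unitaryGroup_iff'.1 V.2

lemma coe_inv_unitary {N : ℕ} (V : U N) : (V⁻¹).1 = V.1ᴴ := rfl

/-! ### Coordinate projections and simultaneous diagonalization -/

section Labels

variable {N : ℕ} {ι : Type*} [DecidableEq ι]

/-- The diagonal projection onto the coordinates with label `i`. -/
def labelDiag (l : Fin N → ι) (i : ι) : Matrix (Fin N) (Fin N) ℂ :=
  Matrix.diagonal fun x => if l x = i then 1 else 0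

lemma commute_diagonal_iff (v : Fin N → ℂ) (M : Matrix (Fin N) (Fin N) ℂ) :
    Matrix.diagonal v * M = M * Matrix.diagonal v ↔ ∀ x y, v x ≠ v y → M x y = 0 := by
  rw [← Matrix.ext_iff]
  refine forall₂_congr fun x y => ?_
  rw [Matrix.diagonal_mul, Matrix.mul_diagonal, mul_comm (M x y), mul_eq_mul_right_iff]
  tauto

lemma commute_labelDiag_iff (l : Fin N → ι) (M : Matrix (Fin N) (Fin N) ℂ) :
    (∀ i, labelDiag l i * M = M * labelDiag l i) ↔ ∀ x y, l x ≠ l y → M x y = 0 := by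
  simp only [labelDiag, commute_diagonal_iff]
  constructor
  · intro h x y hxy
    refine h (l x) x y ?_
    simp [hxy.symm]
  · intro h i x y hxy
    refine h x y fun h2 => hxy ?_
    rw [h2]

/-- Both sides force the same entries to vanish, because distinct labels carry distinct values. This
is how eigenvalues are traded for labels. -/
lemma commute_diagonal_comp_iff (l : Fin N → ι) {c : ι → ℂ} (hc : Function.Injective c)
    (M : Matrix (Fin N) (Fin N) ℂ) :
    (Matrix.diagonal (fun x => c (l x)) * M = M * Matrix.diagonal fun x => c (l x)) ↔
      ∀ i, labelDiag l i * M = M * labelDiag l i := by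
  rw [commute_diagonal_iff, commute_labelDiag_iff]
  simp only [ne_eq, hc.eq_iff]

lemma labelDiag_isHermitian (l : Fin N → ι) (i : ι) : (labelDiag l i)ᴴ = labelDiag l i := by
  rw [labelDiag, Matrix.diagonal_conjTranspose]
  congr 1; ext x; simp only [Pi.star_apply]; split <;> simp

lemma labelDiag_mul (l : Fin N → ι) (i j : ι) :
    labelDiag l i * labelDiag l j = if i = j then labelDiag l i else 0 := by
  rw [labelDiag, labelDiag, Matrix.diagonal_mul_diagonal]
  split_ifs with h
  · subst h; congr 1; ext x; simp
  · rw [← Matrix.diagonal_zero]; congr 1; ext x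
    by_cases h1 : l x = i <;> simp_all

lemma sum_labelDiag [Fintype ι] (l : Fin N → ι) : ∑ i, labelDiag l i = 1 := by
  ext x y
  simp [labelDiag, Matrix.sum_apply, Matrix.diagonal_apply, Matrix.one_apply]

lemma sum_smul_labelDiag [Fintype ι] (l : Fin N → ι) (c : ι → ℂ) :
    ∑ i, c i • labelDiag l i = Matrix.diagonal fun x => c (l x) := by
  ext x y
  simp [labelDiag, Matrix.sum_apply, Matrix.diagonal_apply]

lemma trace_labelDiag (l : Fin N → ι) (i : ι) :
    (labelDiag l i).trace = (Finset.univ.filter fun x => l x = i).card := by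
  simp [labelDiag, Matrix.trace_diagonal]

lemma trace_unitary_conj (V : U N) (M : Matrix (Fin N) (Fin N) ℂ) :
    (V.1 * M * V.1ᴴ).trace = M.trace := by
  rw [Matrix.trace_mul_comm, ← mul_assoc, conjTranspose_mul_coe, one_mul]

/-- A family of mutually orthogonal Hermitian projections that sum to `1` is simultaneously
diagonalizable by a unitary matrix. -/
lemma exists_unitary_labelDiag [Fintype ι] (F : ι → Matrix (Fin N) (Fin N) ℂ)
    (hF : ∀ i, (F i)ᴴ = F i) (hmul : ∀ i j, F i * F j = if i = j then F i else 0)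
    (hsum : ∑ i, F i = 1) :
    ∃ (V : U N) (l : Fin N → ι), ∀ i, F i = V.1 * labelDiag l i * V.1ᴴ := by
  classical
  -- Distinct real weights encode the whole family in one Hermitian matrix H = ∑ cᵢ Fᵢ, so that
  -- diagonalizing H diagonalizes every Fᵢ.
  let c : ι → ℝ := fun i => ((Fintype.equivFin ι i : ℕ) : ℝ)
  have hc : Function.Injective c := fun i j h => by
    simpa [c, Fin.val_inj] using h
  let H : Matrix (Fin N) (Fin N) ℂ := ∑ i, (c i : ℂ) • F i
  have hH : H.IsHermitian := by
    simp [H, Matrix.IsHermitian, Matrix.conjTranspose_sum, Matrix.conjTranspose_smul, hF]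
  let V : U N := hH.eigenvectorUnitary
  let μ := hH.eigenvalues
  have hspec : H = V.1 * Matrix.diagonal (fun a => (μ a : ℂ)) * V.1ᴴ := hH.spectral_theorem
  have hHV : H * V.1 = V.1 * Matrix.diagonal (fun a => (μ a : ℂ)) := by
    rw [hspec, mul_assoc, conjTranspose_mul_coe, mul_one]
  have hFH : ∀ i, F i * H = (c i : ℂ) • F i := by
    intro i
    simp [H, Finset.mul_sum, hmul]
  have hzero : ∀ i x a, c i ≠ μ a → (F i * V.1) x a = 0 := by
    intro i x a hne
    have h1 : (c i : ℂ) • (F i * V.1) = F i * V.1 * Matrix.diagonal (fun a => (μ a : ℂ)) := by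
      rw [mul_assoc, ← hHV, ← mul_assoc, hFH, Matrix.smul_mul]
    have h2 := congrFun (congrFun h1 x) a
    rw [Matrix.mul_diagonal, Matrix.smul_apply, smul_eq_mul, mul_comm, mul_eq_mul_left_iff] at h2
    refine h2.resolve_left fun h3 => hne ?_
    exact_mod_cast h3
  have hsumV : ∀ x a, ∑ i, (F i * V.1) x a = V.1 x a := by
    intro x a
    rw [← Matrix.sum_apply, ← Finset.sum_mul, hsum, one_mul]
  -- An eigenvalue outside the weights would give a column of V killed by every Fᵢ, hence zero,
  -- which unitarity forbids.
  have hex : ∀ a, ∃ i, c i = μ a := by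
    intro a
    by_contra! h
    have h1 : ∀ x, V.1 x a = 0 := fun x => by
      rw [← hsumV]; exact Finset.sum_eq_zero fun i _ => hzero i x a (h i)
    have h2 := congrFun (congrFun (conjTranspose_mul_coe V) a) a
    simp [Matrix.mul_apply, h1] at h2
  choose l hl using hex
  refine ⟨V, l, fun i => ?_⟩
  have key : F i * V.1 = V.1 * labelDiag l i := by
    ext x a
    rw [labelDiag, Matrix.mul_diagonal]
    by_cases h : l a = i
    · rw [if_pos h, mul_one, ← hsumV x a, Finset.sum_eq_single i]
      · intro j _ hj
        refine hzero j x a fun h2 => hj ?_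
        rw [← h]; exact hc (h2.trans (hl a).symm)
      · simp
    · rw [if_neg h, mul_zero]
      refine hzero i x a fun h2 => h ?_
      exact (hc (h2.trans (hl a).symm)).symm
  rw [← key, mul_assoc, coe_mul_conjTranspose, mul_one]

lemma exists_equiv_of_card_fiber {α : Type*} [Fintype α] [Fintype ι] (l : α → ι) (k : ι → ℕ)
    (hk : ∀ i, (Finset.univ.filter fun x => l x = i).card = k i) :
    ∃ f : (Σ i, Fin (k i)) ≃ α, ∀ x, l (f x) = x.1 := by
  have h : ∀ i, Nonempty (Fin (k i) ≃ {x // l x = i}) := fun i => by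
    refine ⟨Fintype.equivOfCardEq ?_⟩
    rw [Fintype.card_fin, Fintype.card_subtype, hk]
  refine ⟨(Equiv.sigmaCongrRight fun i => (h i).some).trans (Equiv.sigmaFiberEquiv l), ?_⟩
  rintro ⟨i, x⟩
  exact ((h i).some x).2

lemma exists_perm_of_card_fiber_eq {α : Type*} [Fintype α] [Fintype ι] (l l' : α → ι)
    (h : ∀ i, (Finset.univ.filter fun x => l x = i).card =
      (Finset.univ.filter fun x => l' x = i).card) :
    ∃ σ : Equiv.Perm α, ∀ x, l' (σ x) = l x := by
  obtain ⟨f, hf⟩ := exists_equiv_of_card_fiber l _ fun _ => rfl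
  obtain ⟨f', hf'⟩ := exists_equiv_of_card_fiber l' _ fun i => (h i).symm
  refine ⟨f.symm.trans f', fun x => ?_⟩
  rw [Equiv.trans_apply, hf', ← hf, Equiv.apply_symm_apply]

end Labels

/-! ### Permutation matrices and unitary equivalence of projection families -/

section PermMat

variable {N : ℕ}

lemma permMat_mul_apply (π : Equiv.Perm (Fin N)) (M : Matrix (Fin N) (Fin N) ℂ) (y x : Fin N) :
    (permMat π * M) y x = M (π.symm y) x := by
  simp [permMat, Matrix.mul_apply, ← Equiv.symm_apply_eq, ite_mul]

lemma mul_permMat_apply (π : Equiv.Perm (Fin N)) (M : Matrix (Fin N) (Fin N) ℂ) (y x : Fin N) :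
    (M * permMat π) y x = M y (π x) := by
  simp [permMat, Matrix.mul_apply]

lemma conjTranspose_permMat (π : Equiv.Perm (Fin N)) : (permMat π)ᴴ = permMat π.symm := by
  ext x y
  simp only [permMat, Matrix.conjTranspose_apply, Matrix.of_apply, Equiv.eq_symm_apply]
  simp only [eq_comm (a := y)]
  split_ifs <;> simp

/-- A permutation matrix as an element of the unitary group. -/
def permUnitary (π : Equiv.Perm (Fin N)) : U N :=
  ⟨permMat π, by
    rw [Matrix.mem_unitaryGroup_iff, Matrix.star_eq_conjTranspose, conjTranspose_permMat]
    ext y x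
    rw [permMat_mul_apply]
    simp [permMat, Matrix.one_apply]⟩

lemma permMat_conj_labelDiag {ι : Type*} [DecidableEq ι] (π : Equiv.Perm (Fin N)) (l : Fin N → ι)
    (i : ι) : permMat π * labelDiag l i * (permMat π)ᴴ = labelDiag (fun x => l (π.symm x)) i := by
  ext y x
  rw [conjTranspose_permMat, mul_permMat_apply, permMat_mul_apply]
  simp [labelDiag, Matrix.diagonal_apply]

/-- Two families of mutually orthogonal Hermitian projections that sum to `1` and have the same
traces are unitarily equivalent. -/
lemma exists_unitary_conj_of_trace_eq {ι : Type*} [DecidableEq ι] [Fintype ι]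
    (F F' : ι → Matrix (Fin N) (Fin N) ℂ)
    (hF : ∀ i, (F i)ᴴ = F i) (hmul : ∀ i j, F i * F j = if i = j then F i else 0)
    (hsum : ∑ i, F i = 1)
    (hF' : ∀ i, (F' i)ᴴ = F' i) (hmul' : ∀ i j, F' i * F' j = if i = j then F' i else 0)
    (hsum' : ∑ i, F' i = 1) (htr : ∀ i, (F i).trace = (F' i).trace) :
    ∃ W : U N, ∀ i, F' i = W.1 * F i * W.1ᴴ := by
  obtain ⟨V, l, hV⟩ := exists_unitary_labelDiag F hF hmul hsum
  obtain ⟨V', l', hV'⟩ := exists_unitary_labelDiag F' hF' hmul' hsum'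
  -- After diagonalization a trace counts the positions with a given label, so equal traces allow
  -- the labels to be matched by a permutation.
  obtain ⟨σ, hσ⟩ := exists_perm_of_card_fiber_eq l l' fun i => by
    have := htr i
    rw [hV, hV', trace_unitary_conj, trace_unitary_conj, trace_labelDiag, trace_labelDiag] at this
    exact_mod_cast this
  refine ⟨V' * permUnitary σ * V⁻¹, fun i => ?_⟩
  have h1 : labelDiag l' i = permMat σ * labelDiag l i * (permMat σ)ᴴ := by
    rw [permMat_conj_labelDiag]
    congr 1
    ext x
    rw [← hσ, Equiv.apply_symm_apply]
  rw [hV', h1, hV]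
  simp only [Submonoid.coe_mul, coe_inv_unitary, permUnitary, Matrix.conjTranspose_mul,
    Matrix.conjTranspose_conjTranspose, mul_assoc]
  rw [← mul_assoc V.1ᴴ V.1, conjTranspose_mul_coe, one_mul, ← mul_assoc V.1ᴴ V.1,
    conjTranspose_mul_coe, one_mul]

end PermMat

/-! ### Commuting families of projections and their joint refinement -/

section Aligned

variable {N : ℕ} {ι κ : Type*} [DecidableEq ι] [DecidableEq κ]

lemma coe_mul_conjTranspose_mul (V : U N) (M : Matrix (Fin N) (Fin N) ℂ) :
    V.1 * (V.1ᴴ * M) = M := by rw [← mul_assoc, coe_mul_conjTranspose, one_mul]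

lemma conjTranspose_mul_coe_mul (V : U N) (M : Matrix (Fin N) (Fin N) ℂ) :
    V.1ᴴ * (V.1 * M) = M := by rw [← mul_assoc, conjTranspose_mul_coe, one_mul]

lemma unitary_conj_eq_iff (V : U N) (A B : Matrix (Fin N) (Fin N) ℂ) :
    V.1 * A * V.1ᴴ = B ↔ V.1 * A = B * V.1 := by
  constructor
  · rintro rfl
    rw [mul_assoc _ V.1ᴴ, conjTranspose_mul_coe, mul_one]
  · intro h
    rw [h, mul_assoc, coe_mul_conjTranspose, mul_one]

lemma commute_unitary_conj_iff (V : U N) (A B : Matrix (Fin N) (Fin N) ℂ) :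
    A * (V.1 * B * V.1ᴴ) = V.1 * B * V.1ᴴ * A ↔
      B * (V.1ᴴ * A * V.1) = V.1ᴴ * A * V.1 * B := by
  constructor
  · intro h
    have h2 := congrArg (fun M => V.1ᴴ * M * V.1) h
    simp only [mul_assoc, conjTranspose_mul_coe_mul, conjTranspose_mul_coe, mul_one] at h2
    simp only [mul_assoc, h2]
  · intro h
    have h2 := congrArg (fun M => V.1 * M * V.1ᴴ) h
    simp only [mul_assoc, coe_mul_conjTranspose_mul, coe_mul_conjTranspose, mul_one] at h2
    simp only [mul_assoc, h2]

/-- The projections `Y Dᵢ Y†` and `Eⱼ` commute, where `Dᵢ` and `Eⱼ` are the diagonal projections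
that belong to the labellings `a` and `b`. -/
def IsAligned (a : Fin N → ι) (b : Fin N → κ) (Y : U N) : Prop :=
  ∀ i j, labelDiag b j * (Y.1 * labelDiag a i * Y.1ᴴ) = Y.1 * labelDiag a i * Y.1ᴴ * labelDiag b j

/-- Diagonal values are replaced by labels first on the b side and then, after conjugation by Y, on
the a side. -/
lemma commute_iff_isAligned (a : Fin N → ι) (b : Fin N → κ) {c : ι → ℂ} {d : κ → ℂ}
    (hc : Function.Injective c) (hd : Function.Injective d) (Y : U N) :
    Matrix.diagonal (fun x => d (b x)) * (Y.1 * Matrix.diagonal (fun x => c (a x)) * Y.1ᴴ) =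
      Y.1 * Matrix.diagonal (fun x => c (a x)) * Y.1ᴴ * Matrix.diagonal (fun x => d (b x)) ↔
    IsAligned a b Y := by
  rw [commute_diagonal_comp_iff b hd, IsAligned, forall_comm]
  refine forall_congr' fun j => ?_
  rw [commute_unitary_conj_iff, commute_diagonal_comp_iff a hc]
  exact forall_congr' fun i => (commute_unitary_conj_iff _ _ _).symm

/-- The product `X Dᵢ X† Eⱼ`. -/
def alignProj (a : Fin N → ι) (b : Fin N → κ) (X : Matrix (Fin N) (Fin N) ℂ) (p : ι × κ) :
    Matrix (Fin N) (Fin N) ℂ :=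
  X * labelDiag a p.1 * Xᴴ * labelDiag b p.2

variable {a : Fin N → ι} {b : Fin N → κ} {Y : U N}

lemma IsAligned.conjTranspose_alignProj (h : IsAligned a b Y) (p : ι × κ) :
    (alignProj a b Y.1 p)ᴴ = alignProj a b Y.1 p := by
  simp only [alignProj, Matrix.conjTranspose_mul, labelDiag_isHermitian,
    Matrix.conjTranspose_conjTranspose]
  rw [← h p.1 p.2]
  simp only [mul_assoc]

lemma IsAligned.alignProj_mul (h : IsAligned a b Y) (p q : ι × κ) :
    alignProj a b Y.1 p * alignProj a b Y.1 q = if p = q then alignProj a b Y.1 p else 0 := by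
  have h1 : alignProj a b Y.1 p * alignProj a b Y.1 q =
      Y.1 * (labelDiag a p.1 * labelDiag a q.1) * Y.1ᴴ * (labelDiag b p.2 * labelDiag b q.2) := by
    have h2 : alignProj a b Y.1 p * alignProj a b Y.1 q =
      Y.1 * labelDiag a p.1 * Y.1ᴴ * (labelDiag b p.2 * (Y.1 * labelDiag a q.1 * Y.1ᴴ)) *
        labelDiag b q.2 := by simp only [alignProj, mul_assoc]
    rw [h2, h]
    simp only [mul_assoc, conjTranspose_mul_coe_mul]
  rw [h1, labelDiag_mul, labelDiag_mul]
  by_cases hp : p = q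
  · subst hp; simp [alignProj]
  · rw [if_neg hp]
    rw [Prod.ext_iff, not_and_or] at hp
    rcases hp with hp | hp <;> simp [hp]

lemma sum_alignProj_left [Fintype ι] (a : Fin N → ι) (b : Fin N → κ) (Y : U N) (j : κ) :
    ∑ i, alignProj a b Y.1 (i, j) = labelDiag b j := by
  simp only [alignProj]
  rw [← Finset.sum_mul, ← Finset.sum_mul, ← Finset.mul_sum, sum_labelDiag, mul_one,
    coe_mul_conjTranspose, one_mul]

lemma sum_alignProj_right [Fintype κ] (a : Fin N → ι) (b : Fin N → κ) (Y : U N) (i : ι) :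
    ∑ j, alignProj a b Y.1 (i, j) = Y.1 * labelDiag a i * Y.1ᴴ := by
  simp only [alignProj]
  rw [← Finset.mul_sum, sum_labelDiag, mul_one]

lemma sum_alignProj [Fintype ι] [Fintype κ] (a : Fin N → ι) (b : Fin N → κ) (Y : U N) :
    ∑ p, alignProj a b Y.1 p = 1 := by
  rw [Fintype.sum_prod_type_right]
  simp only [sum_alignProj_left, sum_labelDiag]

/-- The trace of a projection is its rank. This integrality is what separates the strata. -/
lemma IsAligned.exists_trace_eq_natCast [Fintype ι] [Fintype κ] (h : IsAligned a b Y)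
    (p : ι × κ) : ∃ k : ℕ, (alignProj a b Y.1 p).trace = k := by
  obtain ⟨V, l, hV⟩ := exists_unitary_labelDiag _ h.conjTranspose_alignProj h.alignProj_mul
    (sum_alignProj a b Y)
  exact ⟨_, by rw [hV, trace_unitary_conj, trace_labelDiag]⟩

/-- Aligned unitary matrices with the same traces differ by unitary matrices that preserve the
labellings. -/
lemma IsAligned.exists_eq_mul [Fintype ι] [Fintype κ] {Y' : U N} (h : IsAligned a b Y)
    (h' : IsAligned a b Y')
    (htr : ∀ p, (alignProj a b Y.1 p).trace = (alignProj a b Y'.1 p).trace) :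
    ∃ P Q : U N, (∀ j, labelDiag b j * P.1 = P.1 * labelDiag b j) ∧
      (∀ i, labelDiag a i * Q.1 = Q.1 * labelDiag a i) ∧ Y' = P * Y * Q := by
  obtain ⟨W, hW⟩ := exists_unitary_conj_of_trace_eq _ _ h.conjTranspose_alignProj h.alignProj_mul
    (sum_alignProj a b Y) h'.conjTranspose_alignProj h'.alignProj_mul (sum_alignProj a b Y') htr
  -- W carries each joint projection of Y to that of Y'. Summing over i shows that W fixes Eⱼ;
  -- summing over j shows that W carries Y Dᵢ Y† to Y' Dᵢ Y'†, so Y⁻¹W⁻¹Y' commutes with Dᵢ.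
  refine ⟨W, Y⁻¹ * W⁻¹ * Y', fun j => ?_, fun i => ?_, by group⟩
  · rw [eq_comm, ← unitary_conj_eq_iff, ← sum_alignProj_left a b Y j]
    rw [Finset.mul_sum, Finset.sum_mul]
    simp only [← hW]
    rw [sum_alignProj_left, sum_alignProj_left]
  · have h1 : Y'.1 * labelDiag a i * Y'.1ᴴ = W.1 * (Y.1 * labelDiag a i * Y.1ᴴ) * W.1ᴴ := by
      rw [← sum_alignProj_right a b Y i, Finset.mul_sum, Finset.sum_mul]
      simp only [← hW]
      rw [sum_alignProj_right]
    rw [unitary_conj_eq_iff] at h1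
    simp only [Submonoid.coe_mul, coe_inv_unitary]
    rw [mul_assoc _ Y'.1, h1]
    simp only [mul_assoc, conjTranspose_mul_coe_mul]

lemma alignProj_mul_mul {P Q : U N} (hP : ∀ j, labelDiag b j * P.1 = P.1 * labelDiag b j)
    (hQ : ∀ i, labelDiag a i * Q.1 = Q.1 * labelDiag a i) (p : ι × κ) :
    alignProj a b (P * Y * Q).1 p = P.1 * alignProj a b Y.1 p * P.1ᴴ := by
  have h1 := (unitary_conj_eq_iff Q _ _).2 (hQ p.1).symm
  have h2 : P.1ᴴ * labelDiag b p.2 = labelDiag b p.2 * P.1ᴴ := by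
    have := congrArg Matrix.conjTranspose (hP p.2)
    simpa [Matrix.conjTranspose_mul, labelDiag_isHermitian] using this
  simp only [alignProj, Submonoid.coe_mul, Matrix.conjTranspose_mul, mul_assoc, ← h2]
  rw [← mul_assoc (labelDiag a p.1), ← mul_assoc Q.1, ← mul_assoc Q.1, h1]

lemma conj_labelDiag_mul_mul {P Q : U N} (hQ : ∀ i, labelDiag a i * Q.1 = Q.1 * labelDiag a i)
    (i : ι) : (P * Y * Q).1 * labelDiag a i * (P * Y * Q).1ᴴ =
      P.1 * (Y.1 * labelDiag a i * Y.1ᴴ) * P.1ᴴ := by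
  have h1 := (unitary_conj_eq_iff Q _ _).2 (hQ i).symm
  simp only [Submonoid.coe_mul, Matrix.conjTranspose_mul, mul_assoc]
  rw [← mul_assoc (labelDiag a i), ← mul_assoc Q.1, ← mul_assoc Q.1, h1]

lemma IsAligned.mul_mul (h : IsAligned a b Y) {P Q : U N}
    (hP : ∀ j, labelDiag b j * P.1 = P.1 * labelDiag b j)
    (hQ : ∀ i, labelDiag a i * Q.1 = Q.1 * labelDiag a i) : IsAligned a b (P * Y * Q) := by
  intro i j
  have h2 : P.1ᴴ * labelDiag b j = labelDiag b j * P.1ᴴ := by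
    have := congrArg Matrix.conjTranspose (hP j)
    simpa [Matrix.conjTranspose_mul, labelDiag_isHermitian] using this
  have hM := h i j
  rw [conj_labelDiag_mul_mul hQ]
  generalize Y.1 * labelDiag a i * Y.1ᴴ = M at hM
  calc labelDiag b j * (P.1 * M * P.1ᴴ) = labelDiag b j * P.1 * M * P.1ᴴ := by
        simp only [mul_assoc]
    _ = P.1 * (labelDiag b j * M) * P.1ᴴ := by rw [hP]; simp only [mul_assoc]
    _ = P.1 * M * (P.1ᴴ * labelDiag b j) := by rw [hM, h2]; simp only [mul_assoc]
    _ = P.1 * M * P.1ᴴ * labelDiag b j := by simp only [mul_assoc]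

lemma isAligned_permUnitary (a : Fin N → ι) (b : Fin N → κ) (π : Equiv.Perm (Fin N)) :
    IsAligned a b (permUnitary π) := by
  intro i j
  rw [permUnitary, permMat_conj_labelDiag, labelDiag, labelDiag, Matrix.diagonal_mul_diagonal,
    Matrix.diagonal_mul_diagonal]
  simp only [mul_comm]

lemma trace_alignProj_permUnitary (a : Fin N → ι) (b : Fin N → κ) (π : Equiv.Perm (Fin N))
    (p : ι × κ) : (alignProj a b (permUnitary π).1 p).trace =
      (Finset.univ.filter fun x => a x = p.1 ∧ b (π x) = p.2).card := by
  rw [alignProj, permUnitary, permMat_conj_labelDiag, labelDiag, labelDiag,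
    Matrix.diagonal_mul_diagonal, Matrix.trace_diagonal, ← Equiv.sum_comp π]
  simp only [Equiv.symm_apply_apply, ← ite_and, ite_mul, one_mul, zero_mul, Finset.sum_boole]

end Aligned

/-! ### Traces, contingency tables and permutations -/

section Trace

variable {N r s : ℕ}

lemma trace_conj_diagonal_mul {a : Fin N → Fin r} {b : Fin N → Fin s} (c : Fin r → ℂ)
    (d : Fin s → ℂ) (X : Matrix (Fin N) (Fin N) ℂ) :
    (X * Matrix.diagonal (fun x => c (a x)) * Xᴴ * Matrix.diagonal (fun x => d (b x))).trace =
      ∑ i, ∑ j, (alignProj a b X (i, j)).trace * c i * d j := by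
  rw [← sum_smul_labelDiag a, ← sum_smul_labelDiag b]
  simp only [Finset.mul_sum, Finset.sum_mul, Matrix.trace_sum]
  rw [Finset.sum_comm]
  refine Finset.sum_congr rfl fun i _ => Finset.sum_congr rfl fun j _ => ?_
  simp only [alignProj, Matrix.mul_smul, Matrix.smul_mul, Matrix.trace_smul, smul_eq_mul]
  ring

lemma card_label {n : Fin r → ℕ} (e : (Σ i, Fin (n i)) ≃ Fin N) (i : Fin r) :
    (Finset.univ.filter fun x => (e.symm x).1 = i).card = n i := by
  rw [← Fintype.card_subtype]
  rw [← Fintype.card_fin (n i)]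
  refine Fintype.card_congr ((e.symm.subtypeEquiv fun x => ?_).trans
    (Equiv.sigmaSubtype i))
  rfl

/-- Summed over j or over i, the joint projections give Y Dᵢ Y† or Eⱼ, whose traces are the block
sizes nᵢ and mⱼ. -/
lemma IsAligned.exists_table {n : Fin r → ℕ} {m : Fin s → ℕ} {e : (Σ i, Fin (n i)) ≃ Fin N}
    {e' : (Σ j, Fin (m j)) ≃ Fin N} {Y : U N}
    (h : IsAligned (fun x => (e.symm x).1) (fun x => (e'.symm x).1) Y) :
    ∃ K : ContingencyTable n m, ∀ i j,
      (alignProj (fun x => (e.symm x).1) (fun x => (e'.symm x).1) Y.1 (i, j)).trace =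
        K.entry i j := by
  choose k hk using h.exists_trace_eq_natCast
  refine ⟨⟨fun i j => k (i, j), fun i => ?_, fun j => ?_⟩, fun i j => hk (i, j)⟩
  · have h1 := congrArg Matrix.trace
      (sum_alignProj_right (fun x => (e.symm x).1) (fun x => (e'.symm x).1) Y i)
    rw [Matrix.trace_sum, trace_unitary_conj, trace_labelDiag, card_label] at h1
    simp only [hk] at h1
    exact_mod_cast h1
  · have h1 := congrArg Matrix.trace
      (sum_alignProj_left (fun x => (e.symm x).1) (fun x => (e'.symm x).1) Y j)
    rw [Matrix.trace_sum, trace_labelDiag, card_label] at h1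
    simp only [hk] at h1
    exact_mod_cast h1

/-- Cut block i of ρ into pieces of sizes kᵢⱼ (row sums), cut block j of θ likewise (column sums),
and match the pieces with the same (i, j). -/
lemma exists_perm_overlap_eq {n : Fin r → ℕ} {m : Fin s → ℕ} (e : (Σ i, Fin (n i)) ≃ Fin N)
    (e' : (Σ j, Fin (m j)) ≃ Fin N) (K : ContingencyTable n m) :
    ∃ π : Equiv.Perm (Fin N), overlap e e' π = K.entry := by
  let ga : (Σ i, Fin (n i)) ≃ Σ p : Fin r × Fin s, Fin (K.entry p.1 p.2) :=
    (Equiv.sigmaCongrRight fun i => (finCongr (K.row_sum i).symm).trans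
      finSigmaFinEquiv.symm).trans
      (Equiv.sigmaAssocProd (γ := fun i j => Fin (K.entry i j))).symm
  let gb : (Σ j, Fin (m j)) ≃ Σ p : Fin s × Fin r, Fin (K.entry p.2 p.1) :=
    (Equiv.sigmaCongrRight fun j => (finCongr (K.col_sum j).symm).trans
      finSigmaFinEquiv.symm).trans
      (Equiv.sigmaAssocProd (γ := fun j i => Fin (K.entry i j))).symm
  let sw : (Σ p : Fin r × Fin s, Fin (K.entry p.1 p.2)) ≃
      Σ p : Fin s × Fin r, Fin (K.entry p.2 p.1) :=
    Equiv.sigmaCongr (Equiv.prodComm _ _) fun p => Equiv.refl _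
  have hga : ∀ x, (ga x).1.1 = x.1 := fun x => rfl
  have hgb : ∀ x, (gb x).1.1 = x.1 := fun x => rfl
  have hsw : ∀ x, (sw x).1 = x.1.swap := fun x => rfl
  refine ⟨((e.symm.trans ga).trans sw).trans (e'.symm.trans gb).symm, ?_⟩
  ext i j
  have h1 : ∀ x, (e.symm x).1 = (ga (e.symm x)).1.1 := fun x => (hga _).symm
  have h2 : ∀ y : Σ p : Fin s × Fin r, Fin (K.entry p.2 p.1), (gb.symm y).1 = y.1.1 := fun y => by
    rw [← hgb, Equiv.apply_symm_apply]
  rw [overlap, ← Fintype.card_subtype, ← Fintype.card_fin (K.entry i j)]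
  refine Fintype.card_congr (((e.symm.trans ga).subtypeEquiv (q := fun y => y.1 = (i, j))
    fun x => ?_).trans (Equiv.sigmaSubtype (i, j)))
  simp only [Equiv.trans_apply, Equiv.symm_trans_apply, Equiv.symm_symm, Equiv.symm_apply_apply,
    h2, hsw, h1, Prod.ext_iff, Prod.fst_swap]

end Trace

/-! ### Block diagonal unitary subgroups -/

section Blocks

variable {N : ℕ} {ι : Type*} [DecidableEq ι] {n : ι → ℕ}

lemma blockMatrix_apply (e : (Σ i, Fin (n i)) ≃ Fin N) (P : ∀ i, U (n i)) (x y) :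
    blockMatrix e P (e x) (e y) =
      Matrix.blockDiagonal' (fun i => (P i : Matrix (Fin (n i)) (Fin (n i)) ℂ)) x y := by
  simp [blockMatrix]

lemma blockMatrix_one (e : (Σ i, Fin (n i)) ≃ Fin N) :
    blockMatrix e (1 : ∀ i, U (n i)) = 1 := by
  have : (fun i => ((1 : U (n i)) : Matrix (Fin (n i)) (Fin (n i)) ℂ)) = 1 := rfl
  simp only [blockMatrix, Pi.one_apply, this, Matrix.blockDiagonal'_one, Matrix.reindex_apply,
    Matrix.submatrix_one_equiv]

lemma blockMatrix_inv (e : (Σ i, Fin (n i)) ≃ Fin N) (P : ∀ i, U (n i)) :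
    blockMatrix e P⁻¹ = (blockMatrix e P)ᴴ := by
  simp only [blockMatrix, Matrix.reindex_apply, Matrix.conjTranspose_submatrix,
    Matrix.blockDiagonal'_conjTranspose, Pi.inv_apply, coe_inv_unitary]

variable [Fintype ι]

lemma blockMatrix_mul (e : (Σ i, Fin (n i)) ≃ Fin N) (P Q : ∀ i, U (n i)) :
    blockMatrix e (P * Q) = blockMatrix e P * blockMatrix e Q := by
  simp only [blockMatrix, Matrix.reindex_apply, Matrix.submatrix_mul_equiv, Pi.mul_apply,
    Submonoid.coe_mul, Matrix.blockDiagonal'_mul]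

/-- The embedding of a product of unitary groups as the block diagonal unitary matrices. -/
def blockHom (e : (Σ i, Fin (n i)) ≃ Fin N) : (∀ i, U (n i)) →* U N where
  toFun P := ⟨blockMatrix e P, by
    rw [Matrix.mem_unitaryGroup_iff, Matrix.star_eq_conjTranspose, ← blockMatrix_inv,
      ← blockMatrix_mul, mul_inv_cancel, blockMatrix_one]⟩
  map_one' := Subtype.ext (blockMatrix_one e)
  map_mul' P Q := Subtype.ext (blockMatrix_mul e P Q)

lemma coe_blockHom (e : (Σ i, Fin (n i)) ≃ Fin N) (P : ∀ i, U (n i)) :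
    (blockHom e P).1 = blockMatrix e P := rfl

lemma blockHom_injective (e : (Σ i, Fin (n i)) ≃ Fin N) : Function.Injective (blockHom e) := by
  intro P Q h
  have h1 := (Matrix.reindex e e).injective (congrArg Subtype.val h)
  have h2 := Matrix.blockDiagonal'_injective h1
  funext i
  exact Subtype.ext (congrFun h2 i)

lemma continuous_blockHom (e : (Σ i, Fin (n i)) ≃ Fin N) : Continuous (blockHom e) := by
  refine Continuous.subtype_mk ?_ _
  refine Continuous.matrix_reindex ?_ e e
  refine Continuous.matrix_blockDiagonal' ?_
  fun_prop

lemma mem_range_blockHom (e : (Σ i, Fin (n i)) ≃ Fin N) (V : U N) :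
    V ∈ (blockHom e).range ↔ ∀ x y, (e.symm x).1 ≠ (e.symm y).1 → V.1 x y = 0 := by
  constructor
  · rintro ⟨P, rfl⟩ x y hxy
    obtain ⟨x, rfl⟩ := e.surjective x
    obtain ⟨y, rfl⟩ := e.surjective y
    rw [coe_blockHom, blockMatrix_apply]
    rw [e.symm_apply_apply, e.symm_apply_apply] at hxy
    exact Matrix.blockDiagonal'_apply_ne _ _ _ hxy
  · intro h
    have hV : V.1 = Matrix.reindex e e (Matrix.blockDiagonal'
        (Matrix.blockDiag' (Matrix.reindex e.symm e.symm V.1))) := by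
      ext x y
      obtain ⟨⟨i, x⟩, rfl⟩ := e.surjective x
      obtain ⟨⟨j, y⟩, rfl⟩ := e.surjective y
      simp only [Matrix.reindex_apply, Matrix.submatrix_apply, e.symm_apply_apply]
      by_cases hij : i = j
      · subst hij
        simp [Matrix.blockDiag'_apply]
      · rw [Matrix.blockDiagonal'_apply_ne _ _ _ hij]
        exact h _ _ (by simpa using hij)
    set B := Matrix.blockDiag' (Matrix.reindex e.symm e.symm V.1) with hB
    -- V V† = 1 is read block by block, so each diagonal block is itself unitary.
    have h1 : Matrix.blockDiagonal' (fun i => B i * (B i)ᴴ) = Matrix.blockDiagonal' 1 := by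
      apply (Matrix.reindex e e).injective
      have h2 := coe_mul_conjTranspose V
      rw [Matrix.blockDiagonal'_mul, ← Matrix.blockDiagonal'_conjTranspose,
        Matrix.blockDiagonal'_one]
      rw [hV] at h2
      simpa [Matrix.reindex_apply] using h2
    have h3 := Matrix.blockDiagonal'_injective h1
    exact ⟨fun i => ⟨B i, Matrix.mem_unitaryGroup_iff.2 (congrFun h3 i)⟩, Subtype.ext hV.symm⟩

lemma mem_range_blockHom_iff_commute (e : (Σ i, Fin (n i)) ≃ Fin N) (V : U N) :
    V ∈ (blockHom e).range ↔
      ∀ i, labelDiag (fun x => (e.symm x).1) i * V.1 =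
        V.1 * labelDiag (fun x => (e.symm x).1) i := by
  rw [mem_range_blockHom, commute_labelDiag_iff]

/-- Lift a continuous homomorphism with block diagonal values to the product of the blocks. -/
lemma exists_lift_blockHom {G : Type*} [Group G] [TopologicalSpace G]
    (e : (Σ i, Fin (n i)) ≃ Fin N) (ψ : G →* U N) (hψ : Continuous ψ)
    (h : ∀ g, ψ g ∈ (blockHom e).range) :
    ∃ φ : G →* (∀ i, U (n i)), Continuous φ ∧ ∀ g, blockHom e (φ g) = ψ g := by
  -- An injective continuous map from a compact space to a Hausdorff space is an embedding, so
  -- continuity of the lift can be tested after `blockHom e`.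
  have hind : Topology.IsInducing (blockHom e) :=
    ((continuous_blockHom e).isClosedEmbedding (blockHom_injective e)).isInducing
  let φ : G →* (∀ i, U (n i)) :=
    ((MonoidHom.ofInjective (blockHom_injective e)).symm : _ →* _).comp (ψ.codRestrict _ h)
  have hφ : ∀ g, blockHom e (φ g) = ψ g := fun g =>
    congrArg Subtype.val ((MonoidHom.ofInjective (blockHom_injective e)).apply_symm_apply
      (⟨ψ g, h g⟩ : (blockHom e).range))
  refine ⟨φ, ?_, hφ⟩
  rw [hind.continuous_iff]
  have : blockHom e ∘ φ = ψ := funext hφ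
  rwa [this]

end Blocks

/-! ### Orbit spaces of compact groups -/

section Quotient

lemma mul_mul_inv_eq_iff {G : Type*} [Group G] (p p' q q' t : G) :
    p * t * q⁻¹ = p' * t * q'⁻¹ ↔ p⁻¹ * p' = t * (q⁻¹ * q') * t⁻¹ := by
  constructor
  · intro h
    have : p⁻¹ * p' = p⁻¹ * (p' * t * q'⁻¹) * q' * t⁻¹ := by group
    rw [this, ← h]
    group
  · intro h
    have : p' = p * (p⁻¹ * p') := by group
    rw [this, h]
    group

/-- The induced map on the compact quotient is a continuous bijection onto a Hausdorff space. -/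
lemma exists_homeomorph_quotient {G X : Type*} [Group G] [TopologicalSpace G]
    [CompactSpace G] [TopologicalSpace X] [T2Space X] (H : Subgroup G) (g : G → X)
    (hg : Continuous g) (hH : ∀ x y, g x = g y ↔ x⁻¹ * y ∈ H) (hs : Function.Surjective g) :
    ∃ h : (G ⧸ H) ≃ₜ X, ∀ x, h (QuotientGroup.mk x) = g x := by
  let q : G ⧸ H → X := Quotient.lift g fun x y hxy => (hH x y).2 (QuotientGroup.leftRel_apply.1 hxy)
  have hq : Continuous q := hg.quotient_lift _
  have hb : Function.Bijective q := by
    constructor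
    · rintro ⟨x⟩ ⟨y⟩ hxy
      exact QuotientGroup.eq.2 ((hH x y).1 hxy)
    · intro x
      obtain ⟨y, rfl⟩ := hs x
      exact ⟨QuotientGroup.mk y, rfl⟩
  exact ⟨Continuous.homeoOfEquivCompactToT2 (f := Equiv.ofBijective q hb) hq, fun x => rfl⟩

end Quotient

/-! ### The double coset orbit and its stabilizer U(K) -/

section Orbit

variable {N r s : ℕ} {n : Fin r → ℕ} {m : Fin s → ℕ}

/-- The double coset parametrization `(P, Q) ↦ S P π Q† R†`. -/
def orbitMap (e : (Σ i, Fin (n i)) ≃ Fin N) (e' : (Σ j, Fin (m j)) ≃ Fin N) (R S : U N)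
    (π : Equiv.Perm (Fin N)) (x : UProd m × UProd n) : U N :=
  S * (blockHom e' x.1 * permUnitary π * (blockHom e x.2)⁻¹) * R⁻¹

lemma continuous_orbitMap (e : (Σ i, Fin (n i)) ≃ Fin N) (e' : (Σ j, Fin (m j)) ≃ Fin N)
    (R S : U N) (π : Equiv.Perm (Fin N)) : Continuous (orbitMap e e' R S π) := by
  have h1 := continuous_blockHom e
  have h2 := continuous_blockHom e'
  unfold orbitMap
  fun_prop

lemma coe_orbitMap (e : (Σ i, Fin (n i)) ≃ Fin N) (e' : (Σ j, Fin (m j)) ≃ Fin N) (R S : U N)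
    (π : Equiv.Perm (Fin N)) (P : UProd m) (Q : UProd n) :
    (orbitMap e e' R S π (P, Q)).1 =
      S.1 * (blockMatrix e' P * permMat π * (blockMatrix e Q).conjTranspose) *
        R.1.conjTranspose := rfl

lemma range_orbitMap (e : (Σ i, Fin (n i)) ≃ Fin N) (e' : (Σ j, Fin (m j)) ≃ Fin N) (R S : U N)
    (π : Equiv.Perm (Fin N)) :
    Set.range (orbitMap e e' R S π) = {V : U N | ∃ (P : UProd m) (Q : UProd n),
      V.1 = S.1 * (blockMatrix e' P * permMat π * blockMatrix e Q) * R.1.conjTranspose} := by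
  ext V
  constructor
  · rintro ⟨⟨P, Q⟩, rfl⟩
    exact ⟨P, Q⁻¹, by rw [coe_orbitMap, blockMatrix_inv]⟩
  · rintro ⟨P, Q, h⟩
    exact ⟨(P, Q⁻¹), Subtype.ext (by
      rw [coe_orbitMap, blockMatrix_inv, Matrix.conjTranspose_conjTranspose, h])⟩

/-- (P, Q) and (P', Q') have the same image iff P⁻¹P' is the π-conjugate of Q⁻¹Q'. So the stabilizer
consists of the V in U(n) with πVπ† in U(m), which are the matrices block diagonal for the joint
labelling of x by its ρ-block and the θ-block of π x. -/
lemma exists_stabilizer (e : (Σ i, Fin (n i)) ≃ Fin N) (e' : (Σ j, Fin (m j)) ≃ Fin N)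
    (R S : U N) (π : Equiv.Perm (Fin N)) (K : ContingencyTable n m)
    (hπ : overlap e e' π = K.entry) :
    ∃ (f : (Σ p : K.Support, Fin (K.entry p.1.1 p.1.2)) ≃ Fin N)
      (φ : K.UK →* UProd m × UProd n),
      (∀ x, (e.symm (f x)).1 = x.1.1.1 ∧ (e'.symm (π (f x))).1 = x.1.1.2) ∧
      Continuous φ ∧ Function.Injective φ ∧
      (∀ W : K.UK, blockMatrix e (φ W).2 = blockMatrix f W ∧
        blockMatrix e' (φ W).1 = permMat π * blockMatrix f W * (permMat π).conjTranspose) ∧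
      ∀ x y, orbitMap e e' R S π x = orbitMap e e' R S π y ↔ x⁻¹ * y ∈ φ.range := by
  have hov : ∀ i j, (Finset.univ.filter fun x : Fin N =>
      (e.symm x).1 = i ∧ (e'.symm (π x)).1 = j).card = K.entry i j := fun i j => by
    rw [← hπ]; rfl
  -- The joint label takes values in the support because x itself is counted by the corresponding
  -- entry.
  let l : Fin N → K.Support := fun x => ⟨((e.symm x).1, (e'.symm (π x)).1), by
    rw [← hov, ← Nat.pos_iff_ne_zero, Finset.card_pos]
    exact ⟨x, by simp⟩⟩
  obtain ⟨f, hf⟩ := exists_equiv_of_card_fiber l (fun p => K.entry p.1.1 p.1.2) fun p => by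
    rw [← hov]
    congr 1
    ext x
    simp [l, Subtype.ext_iff, Prod.ext_iff]
  have hfl : ∀ x, (f.symm x).1 = l x := fun x => by rw [← hf, f.apply_symm_apply]
  have hfr : ∀ V : U N, V ∈ (blockHom f).range ↔ V ∈ (blockHom e).range ∧
      permUnitary π * V * (permUnitary π)⁻¹ ∈ (blockHom e').range := by
    intro V
    have hc : ∀ x y, (permUnitary π * V * (permUnitary π)⁻¹).1 x y = V.1 (π.symm x) (π.symm y) := by
      intro x y
      rw [Submonoid.coe_mul, Submonoid.coe_mul, coe_inv_unitary, permUnitary,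
        conjTranspose_permMat, mul_permMat_apply, permMat_mul_apply]
    simp only [mem_range_blockHom, hfl, hc]
    constructor
    · intro h
      refine ⟨fun x y hxy => h x y fun h2 => hxy ?_, fun x y hxy => h _ _ fun h2 => hxy ?_⟩
      · exact congrArg (fun z => z.1.1) h2
      · simpa [l] using congrArg (fun z => z.1.2) h2
    · rintro ⟨h1, h2⟩ x y hxy
      by_cases h3 : (e.symm x).1 = (e.symm y).1
      · have := h2 (π x) (π y) fun h4 => hxy (Subtype.ext (Prod.ext h3 h4))
        simpa using this
      · exact h1 x y h3
  obtain ⟨φ₂, hφ₂c, hφ₂⟩ := exists_lift_blockHom e (blockHom f) (continuous_blockHom f)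
    fun W => ((hfr _).1 ⟨W, rfl⟩).1
  obtain ⟨φ₁, hφ₁c, hφ₁⟩ := exists_lift_blockHom e'
    ((MulAut.conj (permUnitary π)).toMonoidHom.comp (blockHom f))
    (by
      have := continuous_blockHom f
      change Continuous fun W => permUnitary π * blockHom f W * (permUnitary π)⁻¹
      fun_prop)
    fun W => ((hfr _).1 ⟨W, rfl⟩).2
  refine ⟨f, φ₁.prod φ₂, fun x => ?_, hφ₁c.prodMk hφ₂c, ?_, fun W => ⟨?_, ?_⟩, ?_⟩
  · have := hf x
    exact ⟨congrArg (fun z => z.1.1) this, congrArg (fun z => z.1.2) this⟩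
  · intro W W' h
    apply blockHom_injective f
    rw [← hφ₂, ← hφ₂]
    exact congrArg (fun z => blockHom e z.2) h
  · exact congrArg Subtype.val (hφ₂ W)
  · exact congrArg Subtype.val (hφ₁ W)
  · rintro ⟨P, Q⟩ ⟨P', Q'⟩
    have h1 : orbitMap e e' R S π (P, Q) = orbitMap e e' R S π (P', Q') ↔
        blockHom e' (P⁻¹ * P') =
          permUnitary π * blockHom e (Q⁻¹ * Q') * (permUnitary π)⁻¹ := by
      simp only [orbitMap, mul_left_inj, mul_right_inj, map_mul, map_inv]
      exact mul_mul_inv_eq_iff _ _ _ _ _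
    rw [h1]
    constructor
    · intro h
      have h2 : blockHom e (Q⁻¹ * Q') ∈ (blockHom f).range :=
        (hfr _).2 ⟨⟨_, rfl⟩, ⟨_, h⟩⟩
      obtain ⟨W, hW⟩ := h2
      refine ⟨W, Prod.ext (blockHom_injective e' ?_) (blockHom_injective e ?_)⟩
      · exact (hφ₁ W).trans (by rw [← hW] at h; exact h.symm)
      · exact (hφ₂ W).trans hW
    · rintro ⟨W, hW⟩
      have hW1 : φ₁ W = P⁻¹ * P' := congrArg Prod.fst hW
      have hW2 : φ₂ W = Q⁻¹ * Q' := congrArg Prod.snd hW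
      rw [← hW1, ← hW2, hφ₁, hφ₂]
      rfl

end Orbit

/-! ### The derivative of J and the critical equation -/

section Critical

open scoped Matrix.Norms.L2Operator ComplexOrder

variable {N : ℕ}

lemma hasDerivAt_landscape_exp (ρ θ : Matrix (Fin N) (Fin N) ℂ) (V : U N)
    (A : Matrix (Fin N) (Fin N) ℂ) (hA : A.IsHermitian) :
    HasDerivAt (fun t : ℝ => landscape ρ θ
      (NormedSpace.exp ((Complex.I * (t : ℂ)) • A) * (V : Matrix (Fin N) (Fin N) ℂ)))
      (Complex.I * (A * (V.1 * ρ * V.1ᴴ * θ - θ * (V.1 * ρ * V.1ᴴ))).trace).re 0 := by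
  set M := V.1 * ρ * V.1ᴴ with hM
  -- Replacing the adjoint of exp(itA) by exp(-izA) gives a holomorphic function of z whose real
  -- part agrees with the landscape for real z.
  let e : ℂ → ℂ := fun z => (NormedSpace.exp (z • (Complex.I • A)) * M *
    NormedSpace.exp (z • (-(Complex.I • A))) * θ).trace
  have he : HasDerivAt e (Complex.I * (A * (M * θ - θ * M)).trace) ((0 : ℝ) : ℂ) := by
    have h1 := hasDerivAt_exp_smul_const (𝕂 := ℂ) (Complex.I • A) ((0 : ℝ) : ℂ)
    have h2 := hasDerivAt_exp_smul_const (𝕂 := ℂ) (-(Complex.I • A)) ((0 : ℝ) : ℂ)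
    have h3 := ((h1.mul_const M).mul h2).mul_const θ
    have h4 := (Matrix.traceLinearMap (Fin N) ℂ ℂ).toContinuousLinearMap.hasFDerivAt.comp_hasDerivAt
      _ h3
    refine h4.congr_deriv ?_
    simp only [Complex.ofReal_zero, zero_smul, NormedSpace.exp_zero, one_mul, mul_one,
      LinearMap.coe_toContinuousLinearMap', Matrix.traceLinearMap_apply, mul_neg, add_mul, neg_mul,
      Matrix.smul_mul, Matrix.mul_smul, Matrix.trace_add, Matrix.trace_neg, Matrix.trace_smul,
      mul_sub, Matrix.trace_sub, smul_eq_mul]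
    rw [← mul_assoc A θ M, Matrix.trace_mul_cycle A θ M, ← mul_assoc A M θ]
    ring
  refine he.real_of_complex.congr_of_eventuallyEq (Filter.Eventually.of_forall fun t => ?_)
  have h5 : (NormedSpace.exp ((Complex.I * (t : ℂ)) • A))ᴴ =
      NormedSpace.exp ((t : ℂ) • (-(Complex.I • A))) := by
    rw [← Matrix.exp_conjTranspose, Matrix.conjTranspose_smul, hA.eq]
    congr 1
    simp [smul_smul, mul_comm]
  simp only [landscape, e, Matrix.conjTranspose_mul, h5, hM]
  rw [smul_smul, mul_comm (t : ℂ)]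
  simp only [mul_assoc]

/-- The commutator C is skew-Hermitian, so iC is a Hermitian test direction. The derivative along it
is tr(C†C), which vanishes only for C = 0. -/
lemma isCritical_iff_commute {ρ θ : Matrix (Fin N) (Fin N) ℂ} (hρ : ρ.IsHermitian)
    (hθ : θ.IsHermitian) (V : U N) :
    IsCritical ρ θ V ↔ θ * (V.1 * ρ * V.1ᴴ) = V.1 * ρ * V.1ᴴ * θ := by
  constructor
  · intro h
    set C := V.1 * ρ * V.1ᴴ * θ - θ * (V.1 * ρ * V.1ᴴ) with hC
    have hCH : Cᴴ = -C := by
      simp only [hC, Matrix.conjTranspose_sub, Matrix.conjTranspose_mul,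
        Matrix.conjTranspose_conjTranspose, hρ.eq, hθ.eq, neg_sub, mul_assoc]
    have hA : (Complex.I • C).IsHermitian := by
      rw [Matrix.IsHermitian, Matrix.conjTranspose_smul, hCH]
      simp
    have h1 := (hasDerivAt_landscape_exp ρ θ V _ hA).unique (h _ hA)
    rw [← hC] at h1
    have h2 : Complex.I * (Complex.I • C * C).trace = (Cᴴ * C).trace := by
      rw [hCH, Matrix.smul_mul, Matrix.trace_smul, smul_eq_mul, ← mul_assoc, Complex.I_mul_I,
        neg_mul, one_mul, neg_mul, Matrix.trace_neg]
    rw [h2] at h1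
    have h3 : (Cᴴ * C).trace = 0 :=
      Complex.ext h1 (Complex.nonneg_iff.1
        (Matrix.posSemidef_conjTranspose_mul_self C).trace_nonneg).2.symm
    rw [Matrix.trace_conjTranspose_mul_self_eq_zero_iff] at h3
    exact (sub_eq_zero.1 h3).symm
  · intro h A hA
    refine (hasDerivAt_landscape_exp ρ θ V A hA).congr_deriv ?_
    rw [h, sub_self, mul_zero, Matrix.trace_zero, mul_zero, Complex.zero_re]

end Critical

/-! ### Strata are the connected components of the critical set -/

section Strata

variable {N r s : ℕ} {n : Fin r → ℕ} {m : Fin s → ℕ}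
  (e : (Σ i, Fin (n i)) ≃ Fin N) (e' : (Σ j, Fin (m j)) ≃ Fin N) (R S : U N)

/-- The critical points whose projections overlap according to the table `K`. -/
def stratum (K : ContingencyTable n m) : Set (U N) :=
  {V | IsAligned (fun x => (e.symm x).1) (fun x => (e'.symm x).1) (S⁻¹ * V * R) ∧
    ∀ i j, (alignProj (fun x => (e.symm x).1) (fun x => (e'.symm x).1) (S⁻¹ * V * R).1 (i, j)).trace
      = K.entry i j}

lemma blockScalar_isHermitian (v : Fin r → ℝ) : (blockScalar e v)ᴴ = blockScalar e v := by
  rw [blockScalar, Matrix.diagonal_conjTranspose]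
  congr 1; ext x; simp

lemma mem_criticalSet_iff {lam : Fin r → ℝ} {eps : Fin s → ℝ} (hlam : Function.Injective lam)
    (heps : Function.Injective eps) (V : U N) :
    V ∈ criticalSet (R.1 * blockScalar e lam * R.1ᴴ) (S.1 * blockScalar e' eps * S.1ᴴ) ↔
      IsAligned (fun x => (e.symm x).1) (fun x => (e'.symm x).1) (S⁻¹ * V * R) := by
  have hH : ∀ {r : ℕ} {n : Fin r → ℕ} (e : (Σ i, Fin (n i)) ≃ Fin N) (v : Fin r → ℝ) (R : U N),
      (R.1 * blockScalar e v * R.1ᴴ).IsHermitian := fun e v R => by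
    simp only [Matrix.IsHermitian, Matrix.conjTranspose_mul, Matrix.conjTranspose_conjTranspose,
      blockScalar_isHermitian, mul_assoc]
  rw [criticalSet, Set.mem_ofPred_eq, isCritical_iff_commute (hH _ _ _) (hH _ _ _),
    ← commute_iff_isAligned (c := fun i => (lam i : ℂ)) (d := fun j => (eps j : ℂ))
      _ _ (Complex.ofReal_injective.comp hlam) (Complex.ofReal_injective.comp heps), eq_comm,
    commute_unitary_conj_iff, eq_comm, eq_comm (b := _ * Matrix.diagonal _)]
  simp only [blockScalar, Submonoid.coe_mul, coe_inv_unitary, Matrix.conjTranspose_mul,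
    Matrix.conjTranspose_conjTranspose, mul_assoc]

lemma landscape_eq_of_mem_stratum (lam : Fin r → ℝ) (eps : Fin s → ℝ) {K : ContingencyTable n m}
    {V : U N} (hV : V ∈ stratum e e' R S K) :
    landscape (R.1 * blockScalar e lam * R.1ᴴ) (S.1 * blockScalar e' eps * S.1ᴴ) V.1 =
      ∑ i, ∑ j, (K.entry i j : ℝ) * lam i * eps j := by
  have h1 : (V.1 * (R.1 * blockScalar e lam * R.1ᴴ) * V.1ᴴ *
      (S.1 * blockScalar e' eps * S.1ᴴ)).trace
      = ((S⁻¹ * V * R).1 * blockScalar e lam * (S⁻¹ * V * R).1ᴴ * blockScalar e' eps).trace := by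
    rw [← mul_assoc, ← mul_assoc, Matrix.trace_mul_comm]
    simp only [Submonoid.coe_mul, coe_inv_unitary, Matrix.conjTranspose_mul,
      Matrix.conjTranspose_conjTranspose, mul_assoc]
  rw [landscape, h1]
  have h2 := trace_conj_diagonal_mul (a := fun x => (e.symm x).1) (b := fun x => (e'.symm x).1)
    (fun i => (lam i : ℂ)) (fun j => (eps j : ℂ)) (S⁻¹ * V * R).1
  simp only [hV.2] at h2
  rw [blockScalar, blockScalar, h2]
  simp [← Complex.ofReal_natCast, -Complex.ofReal_mul]

lemma stratum_eq_range {K : ContingencyTable n m} {π : Equiv.Perm (Fin N)}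
    (hπ : overlap e e' π = K.entry) : stratum e e' R S K = Set.range (orbitMap e e' R S π) := by
  have htr : ∀ i j, (alignProj (fun x => (e.symm x).1) (fun x => (e'.symm x).1)
      (permUnitary π).1 (i, j)).trace = K.entry i j := fun i j => by
    rw [trace_alignProj_permUnitary, ← hπ]; rfl
  have hal := isAligned_permUnitary (fun x => (e.symm x).1) (fun x => (e'.symm x).1) π
  ext V
  constructor
  · rintro ⟨h1, h2⟩
    obtain ⟨P, Q, hP, hQ, hPQ⟩ := hal.exists_eq_mul h1 fun p => by rw [htr, h2]
    obtain ⟨P, rfl⟩ := (mem_range_blockHom_iff_commute e' P).2 hP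
    obtain ⟨Q, rfl⟩ := (mem_range_blockHom_iff_commute e Q).2 hQ
    refine ⟨(P, Q⁻¹), ?_⟩
    rw [orbitMap, map_inv, inv_inv, ← hPQ]
    group
  · rintro ⟨⟨P, Q⟩, rfl⟩
    have hY : S⁻¹ * orbitMap e e' R S π (P, Q) * R =
        blockHom e' P * permUnitary π * blockHom e Q⁻¹ := by
      rw [orbitMap, map_inv]
      group
    have hP := (mem_range_blockHom_iff_commute e' (blockHom e' P)).1 ⟨P, rfl⟩
    have hQ := (mem_range_blockHom_iff_commute e (blockHom e Q⁻¹)).1 ⟨_, rfl⟩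
    rw [stratum, Set.mem_ofPred_eq, hY]
    refine ⟨hal.mul_mul hP hQ, fun i j => ?_⟩
    rw [alignProj_mul_mul hP hQ, trace_unitary_conj, htr]

lemma isConnected_stratum (K : ContingencyTable n m) : IsConnected (stratum e e' R S K) := by
  obtain ⟨π, hπ⟩ := exists_perm_overlap_eq e e' K
  rw [stratum_eq_range e e' R S hπ]
  exact isConnected_range (continuous_orbitMap e e' R S π)

lemma continuous_trace_alignProj {ι κ : Type*} [DecidableEq ι] [DecidableEq κ] (a : Fin N → ι)
    (b : Fin N → κ) (p : ι × κ) :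
    Continuous fun X : Matrix (Fin N) (Fin N) ℂ => (alignProj a b X p).trace := by
  refine Continuous.matrix_trace (((Continuous.mul ?_ ?_).mul continuous_const))
  · exact continuous_id.mul continuous_const
  · exact continuous_id.matrix_conjTranspose

lemma table_eq_of_mem_stratum {K K' : ContingencyTable n m} {V : U N}
    (h : V ∈ stratum e e' R S K) (h' : V ∈ stratum e e' R S K') : K = K' := by
  have : K.entry = K'.entry := by
    ext i j
    have := (h.2 i j).symm.trans (h'.2 i j)
    exact_mod_cast this
  cases K; cases K'
  simpa using this

variable {ρ θ : Matrix (Fin N) (Fin N) ℂ}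
    (hcrit : ∀ V : U N, V ∈ criticalSet ρ θ ↔
      IsAligned (fun x => (e.symm x).1) (fun x => (e'.symm x).1) (S⁻¹ * V * R))

include hcrit

lemma exists_mem_stratum {V : U N} (hV : V ∈ criticalSet ρ θ) :
    ∃ K : ContingencyTable n m, V ∈ stratum e e' R S K := by
  obtain ⟨K, hK⟩ := ((hcrit V).1 hV).exists_table
  exact ⟨K, (hcrit V).1 hV, hK⟩

/-- A stratum is connected, so it lies in one component. Conversely each trace is continuous and
takes natural number values on the critical set, so it is constant on the component. -/
lemma connectedComponentIn_eq_stratum {K : ContingencyTable n m} {V : U N}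
    (hV : V ∈ stratum e e' R S K) :
    connectedComponentIn (criticalSet ρ θ) V = stratum e e' R S K := by
  have hVc : V ∈ criticalSet ρ θ := (hcrit V).2 hV.1
  refine Set.Subset.antisymm (fun W hW => ?_)
    ((isConnected_stratum e e' R S K).isPreconnected.subset_connectedComponentIn hV
      fun W hW => (hcrit W).2 hW.1)
  have hWc := connectedComponentIn_subset _ _ hW
  obtain ⟨K', hK'⟩ := exists_mem_stratum e e' R S hcrit hWc
  suffices K = K' by rwa [this]
  have hconst : ∀ i j, K.entry i j = K'.entry i j := by
    intro i j
    let f : U N → ℝ := fun X =>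
      (alignProj (fun x => (e.symm x).1) (fun x => (e'.symm x).1) (S⁻¹ * X * R).1 (i, j)).trace.re
    have hf : Continuous f := by
      refine Complex.continuous_re.comp ((continuous_trace_alignProj _ _ _).comp ?_)
      fun_prop
    have : DiscreteTopology (Set.range ((↑) : ℕ → ℝ)) :=
      Nat.isClosedEmbedding_coe_real.isEmbedding.toHomeomorph.symm.isEmbedding.discreteTopology
    have h1 := isPreconnected_connectedComponentIn.constant_of_mapsTo
      (S := connectedComponentIn _ V) (T := Set.range ((↑) : ℕ → ℝ)) (f := f) ⟨this⟩ hf.continuousOn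
      (fun X hX => by
        obtain ⟨K₁, hK₁⟩ := exists_mem_stratum e e' R S hcrit (connectedComponentIn_subset _ _ hX)
        exact ⟨K₁.entry i j, by simp only [f, hK₁.2 i j, Complex.natCast_re]⟩)
      (mem_connectedComponentIn hVc) hW
    simp only [f, hV.2 i j, hK'.2 i j, Complex.natCast_re] at h1
    exact_mod_cast h1
  refine table_eq_of_mem_stratum e e' R S hV ⟨hV.1, fun i j => ?_⟩
  rw [hV.2, hconst]

/-- The contingency tables enumerate the connected components of the critical set. -/
lemma exists_equiv_criticalSubmanifolds :
    ∃ crit : ContingencyTable n m ≃ criticalSubmanifolds ρ θ,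
      ∀ K, (crit K).1 = stratum e e' R S K := by
  let g : ContingencyTable n m → criticalSubmanifolds ρ θ := fun K => ⟨stratum e e' R S K, by
    obtain ⟨V, hV⟩ := (isConnected_stratum e e' R S K).nonempty
    exact ⟨V, (hcrit V).2 hV.1, (connectedComponentIn_eq_stratum e e' R S hcrit hV).symm⟩⟩
  refine ⟨Equiv.ofBijective g ⟨fun K K' h => ?_, ?_⟩, fun K => rfl⟩
  · obtain ⟨V, hV⟩ := (isConnected_stratum e e' R S K).nonempty
    have h2 : stratum e e' R S K = stratum e e' R S K' := congrArg Subtype.val h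
    exact table_eq_of_mem_stratum e e' R S hV (h2 ▸ hV)
  · rintro ⟨M, V, hV, rfl⟩
    obtain ⟨K, hK⟩ := exists_mem_stratum e e' R S hcrit hV
    exact ⟨K, Subtype.ext (connectedComponentIn_eq_stratum e e' R S hcrit hK).symm⟩

end Strata

/-! ### A submersion criterion for submanifolds -/

section Submanifold

/-- A set is a smooth submanifold if near each point it is cut out by a smooth map into a subspace
`T`, all of whose directions are attained by derivatives along lines through the point. -/
lemma isSmoothSubmanifold_of_equations {E E' : Type*} [NormedAddCommGroup E] [NormedSpace ℝ E]
    [NormedAddCommGroup E'] [NormedSpace ℝ E'] [FiniteDimensional ℝ E'] {M : Set E}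
    (h : ∀ p ∈ M, ∃ W : Set E, IsOpen W ∧ p ∈ W ∧ ∃ (G : E → E') (T : Submodule ℝ E'),
      ContDiff ℝ ∞ G ∧ (∀ q, G q ∈ T) ∧
      (∀ t ∈ T, ∃ v, HasDerivAt (fun s : ℝ => G (p + s • v)) t 0) ∧
      M ∩ W = {q ∈ W | G q = 0}) : IsSmoothSubmanifold M := by
  intro p hp
  obtain ⟨W, hW, hpW, G, T, hG, hGT, hsurj, hM⟩ := h p hp
  -- Projecting onto T and taking coordinates loses no equations, as G has values in T, and it makes
  -- the derivative onto.
  obtain ⟨L₀, hL₀⟩ := T.subtype.exists_leftInverse_of_injective T.ker_subtype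
  have hL : ∀ t (ht : t ∈ T), L₀ t = ⟨t, ht⟩ := fun t ht =>
    congrArg (fun f => f ⟨t, ht⟩) hL₀
  let φ : T ≃L[ℝ] (Fin (Module.finrank ℝ T) → ℝ) :=
    ContinuousLinearEquiv.ofFinrankEq (by simp)
  let L : E' →L[ℝ] (Fin (Module.finrank ℝ T) → ℝ) :=
    (φ : T →L[ℝ] _).comp (LinearMap.toContinuousLinearMap L₀)
  have hLφ : ∀ t (ht : t ∈ T), L t = φ ⟨t, ht⟩ := fun t ht => congrArg φ (hL t ht)
  refine ⟨W, hW, hpW, _, fun q => L (G q), (L.contDiff.comp hG).contDiffOn, ?_, ?_⟩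
  · intro z
    obtain ⟨v, hv⟩ := hsurj (φ.symm z : T) (φ.symm z).2
    refine ⟨v, ?_⟩
    have h1 : HasDerivAt (fun s : ℝ => L (G (p + s • v))) z 0 := by
      have := L.hasFDerivAt.comp_hasDerivAt (0 : ℝ) hv
      rwa [hLφ _ (φ.symm z).2, Subtype.coe_eta, φ.apply_symm_apply] at this
    have h2 : DifferentiableAt ℝ (fun q => L (G q)) p :=
      (L.contDiff.comp hG).contDiffAt.differentiableAt (by simp)
    have h3 : HasDerivAt (fun s : ℝ => p + s • v) v 0 := by
      simpa using ((hasDerivAt_id (0 : ℝ)).smul_const v).const_add p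
    have h4 : HasDerivAt (fun s : ℝ => L (G (p + s • v))) (fderiv ℝ (fun q => L (G q)) p v) 0 := by
      refine HasFDerivAt.comp_hasDerivAt (0 : ℝ) (l := fun q => L (G q)) ?_ h3
      simpa using h2.hasFDerivAt
    exact h4.unique h1
  · rw [hM]
    ext q
    refine and_congr_right fun _ => ?_
    change _ ↔ L (G q) = 0
    rw [hLφ _ (hGT q), map_eq_zero_iff φ φ.injective, Submodule.mk_eq_zero]

lemma hasDerivAt_quadratic {E : Type*} [NormedAddCommGroup E] [NormedSpace ℝ E] (c₀ c₁ c₂ : E) :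
    HasDerivAt (fun s : ℝ => c₀ + s • c₁ + s ^ 2 • c₂) c₁ 0 := by
  simpa using (((hasDerivAt_id (0 : ℝ)).smul_const c₁).const_add c₀).fun_add
    ((hasDerivAt_pow 2 (0 : ℝ)).smul_const c₂)

end Submanifold

/-! ### Independent local equations for a stratum near the identity -/

section Equations

variable {N : ℕ}

/-- Keep the entries of `M` at the positions where both `d` and `ε` differ. -/
def offMask (d ε : Fin N → ℝ) : Matrix (Fin N) (Fin N) ℂ →ₗ[ℝ] Matrix (Fin N) (Fin N) ℂ where
  toFun M := Matrix.of fun x y => if d x = d y ∨ ε x = ε y then 0 else M x y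
  map_add' A B := by ext x y; simp only [Matrix.of_apply, Matrix.add_apply]; split_ifs <;> simp
  map_smul' c A := by ext x y; simp only [Matrix.of_apply, Matrix.smul_apply]; split_ifs <;> simp

lemma offMask_apply (d ε : Fin N → ℝ) (M : Matrix (Fin N) (Fin N) ℂ) (x y : Fin N) :
    offMask d ε M x y = if d x = d y ∨ ε x = ε y then 0 else M x y := rfl

/-- The real diagonal matrix with entries `d`. -/
def realDiag (d : Fin N → ℝ) : Matrix (Fin N) (Fin N) ℂ := Matrix.diagonal fun x => (d x : ℂ)

lemma conjTranspose_realDiag (d : Fin N → ℝ) : (realDiag d)ᴴ = realDiag d := by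
  rw [realDiag, Matrix.diagonal_conjTranspose]
  congr 1; ext x; simp

/-- The equations `Z†Z = 1` and `(Z d Z†)ₓᵧ = 0` where `d` and `ε` both differ. -/
def alignEq (d ε : Fin N → ℝ) (Z : Matrix (Fin N) (Fin N) ℂ) :
    Matrix (Fin N) (Fin N) ℂ × Matrix (Fin N) (Fin N) ℂ :=
  (Zᴴ * Z - 1, offMask d ε (Z * realDiag d * Zᴴ))

/-- The real vector space in which `alignEq` takes its values. -/
def alignSpace (d ε : Fin N → ℝ) :
    Submodule ℝ (Matrix (Fin N) (Fin N) ℂ × Matrix (Fin N) (Fin N) ℂ) where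
  carrier := {p | p.1ᴴ = p.1 ∧ p.2ᴴ = p.2 ∧ ∀ x y, d x = d y ∨ ε x = ε y → p.2 x y = 0}
  add_mem' := by
    rintro p q ⟨h1, h2, h3⟩ ⟨h4, h5, h6⟩
    refine ⟨?_, ?_, fun x y h => ?_⟩
    · rw [Prod.fst_add, Matrix.conjTranspose_add, h1, h4]
    · rw [Prod.snd_add, Matrix.conjTranspose_add, h2, h5]
    · rw [Prod.snd_add, Matrix.add_apply, h3 x y h, h6 x y h, add_zero]
  zero_mem' := by simp
  smul_mem' := by
    rintro c p ⟨h1, h2, h3⟩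
    refine ⟨?_, ?_, fun x y h => ?_⟩
    · rw [Prod.smul_fst, Matrix.conjTranspose_smul, h1, star_trivial]
    · rw [Prod.smul_snd, Matrix.conjTranspose_smul, h2, star_trivial]
    · rw [Prod.smul_snd, Matrix.smul_apply, h3 x y h, smul_zero]

lemma alignEq_mem (d ε : Fin N → ℝ) (Z : Matrix (Fin N) (Fin N) ℂ) :
    alignEq d ε Z ∈ alignSpace d ε := by
  refine ⟨?_, ?_, fun x y h => ?_⟩
  · simp [alignEq]
  · have hK : (Z * realDiag d * Zᴴ)ᴴ = Z * realDiag d * Zᴴ := by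
      simp [conjTranspose_realDiag, mul_assoc]
    ext x y
    have := congrFun (congrFun hK x) y
    simp only [alignEq, offMask_apply, Matrix.conjTranspose_apply] at this ⊢
    rw [← this]
    simp only [eq_comm (a := d y), eq_comm (a := ε y)]
    split_ifs <;> simp
  · simp [alignEq, offMask_apply, h]

section Frobenius

open scoped Matrix.Norms.Frobenius

lemma norm_le_norm_of_entries {A B : Matrix (Fin N) (Fin N) ℂ} (h : ∀ x y, ‖A x y‖ ≤ ‖B x y‖) :
    ‖A‖ ≤ ‖B‖ := by
  rw [Matrix.frobenius_norm_def, Matrix.frobenius_norm_def]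
  gcongr
  exact h _ _

/-- Near the identity, the equations `alignEq d ε Z = 0` force the whole of `Z d Z†` to commute with
the diagonal matrix `ε`. -/
lemma exists_nhd_entries_eq_zero (N : ℕ) : ∃ W : Set (Matrix (Fin N) (Fin N) ℂ), IsOpen W ∧ 1 ∈ W ∧
    ∀ (d ε : Fin N → ℝ) (Z : U N), Z.1 ∈ W →
      (∀ x y, d x ≠ d y → ε x ≠ ε y → (Z.1 * realDiag d * Z.1ᴴ) x y = 0) →
      ∀ x y, ε x ≠ ε y → (Z.1 * realDiag d * Z.1ᴴ) x y = 0 := by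
  -- Any radius δ with 2δ + δ² < 1 would do: the estimate below is ‖C‖ ≤ (2δ + δ²)‖C‖.
  refine ⟨{Z | ‖Z - 1‖ < 1 / 3}, isOpen_lt (by fun_prop) (by fun_prop), by simp, ?_⟩
  intro d ε Z hZ h x y hxy
  set K := Z.1 * realDiag d * Z.1ᴴ with hK
  set C := K * realDiag ε - realDiag ε * K with hC
  have hCe : ∀ x y, C x y = K x y * (ε y - ε x) := fun x y => by
    rw [hC, Matrix.sub_apply, realDiag, Matrix.mul_diagonal, Matrix.diagonal_mul]
    ring
  have hC0 : ∀ x y, d x ≠ d y → C x y = 0 := fun x y hd => by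
    rw [hCe]
    by_cases hε : ε x = ε y
    · simp [hε]
    · rw [h x y hd hε, zero_mul]
  have hconj : Z.1ᴴ * C * Z.1 =
      realDiag d * (Z.1ᴴ * realDiag ε * Z.1) - Z.1ᴴ * realDiag ε * Z.1 * realDiag d := by
    rw [hC, mul_sub, sub_mul, hK]
    simp only [mul_assoc, conjTranspose_mul_coe_mul, conjTranspose_mul_coe, mul_one]
  have hD0 : ∀ x y, d x = d y → (Z.1ᴴ * C * Z.1) x y = 0 := fun x y hd => by
    rw [hconj, Matrix.sub_apply, realDiag, Matrix.diagonal_mul, Matrix.mul_diagonal, hd]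
    ring
  -- C = [ZdZ†, ε] lives where d has equal entries, while Z†CZ = [d, Z†εZ] vanishes there. With
  -- disjoint supports, subtracting Z†CZ cannot shrink the Frobenius norm.
  have hle : ‖C‖ ≤ ‖Z.1ᴴ * C * Z.1 - C‖ := by
    refine norm_le_norm_of_entries fun x y => ?_
    by_cases hd : d x = d y
    · rw [Matrix.sub_apply, hD0 x y hd, zero_sub, norm_neg]
    · rw [hC0 x y hd, norm_zero]; exact norm_nonneg _
  have hexp : Z.1ᴴ * C * Z.1 - C =
      (Z.1 - 1)ᴴ * C + C * (Z.1 - 1) + (Z.1 - 1)ᴴ * C * (Z.1 - 1) := by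
    rw [Matrix.conjTranspose_sub, Matrix.conjTranspose_one]
    noncomm_ring
  have hδ : ‖Z.1 - 1‖ < 1 / 3 := hZ
  have hδ' : ‖(Z.1 - 1)ᴴ‖ = ‖Z.1 - 1‖ := Matrix.frobenius_norm_conjTranspose _
  have hn : ‖C‖ ≤ ‖Z.1 - 1‖ * ‖C‖ + ‖C‖ * ‖Z.1 - 1‖ + ‖Z.1 - 1‖ * ‖C‖ * ‖Z.1 - 1‖ := by
    refine hle.trans ?_
    rw [hexp]
    refine (norm_add₃_le).trans ?_
    have h1 := norm_mul_le (Z.1 - 1)ᴴ C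
    have h2 := norm_mul_le C (Z.1 - 1)
    have h3 := norm_mul_le ((Z.1 - 1)ᴴ * C) (Z.1 - 1)
    rw [hδ'] at h1
    have h4 := mul_le_mul_of_nonneg_right h1 (norm_nonneg (Z.1 - 1))
    linarith
  have hC00 : C = 0 := by
    rw [← norm_le_zero_iff]
    nlinarith [norm_nonneg C, norm_nonneg (Z.1 - 1),
      mul_nonneg (norm_nonneg C) (sub_nonneg.2 hδ.le),
      mul_nonneg (mul_nonneg (norm_nonneg (Z.1 - 1)) (norm_nonneg C)) (sub_nonneg.2 hδ.le)]
  have h5 := hCe x y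
  rw [hC00, Matrix.zero_apply, eq_comm, mul_eq_zero] at h5
  refine h5.resolve_right fun h6 => hxy ?_
  rw [sub_eq_zero] at h6
  exact_mod_cast h6.symm

lemma contDiff_alignEq (d ε : Fin N → ℝ) : ContDiff ℝ ∞ (alignEq d ε) := by
  have hstar : ContDiff ℝ ∞ fun Z : Matrix (Fin N) (Fin N) ℂ => Zᴴ :=
    (starL' ℝ : Matrix (Fin N) (Fin N) ℂ ≃L[ℝ] _).contDiff
  have hid : ContDiff ℝ ∞ fun Z : Matrix (Fin N) (Fin N) ℂ => Z := contDiff_id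
  refine ContDiff.prodMk ((hstar.mul hid).sub contDiff_const) ?_
  exact (LinearMap.toContinuousLinearMap (offMask d ε)).contDiff.comp
    ((hid.mul contDiff_const).mul hstar)

/-- The derivative at 1 along W is W + W† paired with the masked part of Wd + dW†. The first fixes
the Hermitian part of W; on masked-in entries the skew part enters the second with the nonzero
factor d y - d x, so it can be solved for. -/
lemma exists_hasDerivAt_alignEq (d ε : Fin N → ℝ)
    {t : Matrix (Fin N) (Fin N) ℂ × Matrix (Fin N) (Fin N) ℂ} (ht : t ∈ alignSpace d ε) :
    ∃ W : Matrix (Fin N) (Fin N) ℂ, HasDerivAt (fun s : ℝ => alignEq d ε (1 + s • W)) t 0 := by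
  obtain ⟨A, B⟩ := t
  obtain ⟨hA, hB, hB0⟩ := ht
  -- The skew part of W, found by solving W d + d W† = B entrywise with W = A/2 + B'. Where d x = d
  -- y, division by zero yields 0, which keeps B' skew-Hermitian.
  let B' : Matrix (Fin N) (Fin N) ℂ := Matrix.of fun x y =>
    (B x y - A x y * (d x + d y) / 2) / (d y - d x)
  let W : Matrix (Fin N) (Fin N) ℂ := (1 / 2 : ℝ) • A + B'
  have hA' : ∀ x y, star (A y x) = A x y := fun x y => congrFun (congrFun hA x) y
  have hB' : ∀ x y, star (B y x) = B x y := fun x y => congrFun (congrFun hB x) y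
  have hB's : B'ᴴ = -B' := by
    ext x y
    have h1 := hA' x y
    have h2 := hB' x y
    simp only [Complex.star_def] at h1 h2
    simp only [B', Matrix.conjTranspose_apply, Matrix.of_apply, Matrix.neg_apply, Complex.star_def,
      map_div₀, map_sub, map_mul, map_add, Complex.conj_ofReal, map_ofNat, h1, h2]
    rw [← div_neg, neg_sub, add_comm (d y : ℂ)]
  have hW : W + Wᴴ = A := by
    simp only [W, Matrix.conjTranspose_add, Matrix.conjTranspose_smul, hA, hB's, star_trivial]
    rw [add_add_add_comm, ← add_smul]
    norm_num
  have hWm : offMask d ε (W * realDiag d + realDiag d * Wᴴ) = B := by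
    ext x y
    rw [offMask_apply]
    split_ifs with hxy
    · exact (hB0 x y hxy).symm
    · have hd : (d y : ℂ) - d x ≠ 0 := by
        rw [sub_ne_zero]
        exact fun h => hxy (Or.inl (Complex.ofReal_injective h.symm))
      have hWH : Wᴴ = A - W := by rw [← hW]; abel
      rw [hWH, Matrix.add_apply, realDiag, Matrix.mul_diagonal, Matrix.diagonal_mul,
        Matrix.sub_apply]
      simp only [W, Matrix.add_apply, Matrix.smul_apply, B', Matrix.of_apply, Complex.real_smul]
      push_cast
      field_simp
      ring
  have h0 : offMask d ε (realDiag d) = 0 := by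
    ext x y
    rw [offMask_apply]
    split_ifs with hxy
    · rfl
    · exact Matrix.diagonal_apply_ne _ fun h => hxy (Or.inl (by rw [h]))
  refine ⟨W, ?_⟩
  -- Along a line through 1 the equations are exactly quadratic in s, with zero constant term, so
  -- the linear coefficient is the derivative.
  have hq := hasDerivAt_quadratic (0 : Matrix (Fin N) (Fin N) ℂ × Matrix (Fin N) (Fin N) ℂ) (A, B)
    (Wᴴ * W, offMask d ε (W * realDiag d * Wᴴ))
  refine hq.congr_of_eventuallyEq (Filter.Eventually.of_forall fun s => Prod.ext ?_ ?_)
  · simp only [alignEq, Prod.fst_add, Prod.smul_fst, ← hW,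
      Matrix.conjTranspose_add, Matrix.conjTranspose_one, Matrix.conjTranspose_smul, star_trivial,
      add_mul, mul_add, one_mul, mul_one, Matrix.smul_mul, Matrix.mul_smul, smul_smul, smul_add,
      zero_add, pow_two]
    abel
  · simp only [alignEq, Prod.snd_add, Prod.smul_snd, ← hWm, ← map_smul,
      Matrix.conjTranspose_add, Matrix.conjTranspose_one, Matrix.conjTranspose_smul, star_trivial,
      add_mul, mul_add, one_mul, mul_one, Matrix.smul_mul, Matrix.mul_smul, smul_smul, smul_add,
      zero_add, pow_two, map_add, h0]
    abel

end Frobenius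

end Equations

/-! ### Smoothness of the strata -/

section Smooth

variable {N r s : ℕ} {n : Fin r → ℕ} {m : Fin s → ℕ}
  (e : (Σ i, Fin (n i)) ≃ Fin N) (e' : (Σ j, Fin (m j)) ≃ Fin N) (R S : U N)

lemma permMat_conj_diagonal (π : Equiv.Perm (Fin N)) (v : Fin N → ℂ) :
    permMat π * Matrix.diagonal v * (permMat π)ᴴ = Matrix.diagonal fun x => v (π.symm x) := by
  ext y x
  rw [conjTranspose_permMat, mul_permMat_apply, permMat_mul_apply]
  simp [Matrix.diagonal_apply]

lemma isAligned_mul_mul_iff {Y P Q : U N} (hP : P ∈ (blockHom e').range)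
    (hQ : Q ∈ (blockHom e).range) :
    IsAligned (fun x => (e.symm x).1) (fun x => (e'.symm x).1) (P * Y * Q) ↔
      IsAligned (fun x => (e.symm x).1) (fun x => (e'.symm x).1) Y := by
  refine ⟨fun h => ?_, fun h => h.mul_mul ((mem_range_blockHom_iff_commute e' P).1 hP)
    ((mem_range_blockHom_iff_commute e Q).1 hQ)⟩
  have h1 := h.mul_mul ((mem_range_blockHom_iff_commute e' P⁻¹).1 (inv_mem hP))
    ((mem_range_blockHom_iff_commute e Q⁻¹).1 (inv_mem hQ))
  have h2 : P⁻¹ * (P * Y * Q) * Q⁻¹ = Y := by group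
  rwa [h2] at h1

lemma isAligned_mul_permUnitary_iff {ι κ : Type*} [DecidableEq ι] [DecidableEq κ] {a : Fin N → ι}
    {b : Fin N → κ} {c : ι → ℝ} {d : κ → ℝ} (hc : Function.Injective c)
    (hd : Function.Injective d) (π : Equiv.Perm (Fin N)) (Z : U N) :
    IsAligned a b (Z * permUnitary π) ↔ ∀ x y, d (b x) ≠ d (b y) →
      (Z.1 * realDiag (fun x => c (a (π.symm x))) * Z.1ᴴ) x y = 0 := by
  rw [← commute_iff_isAligned (c := fun i => (c i : ℂ)) (d := fun j => (d j : ℂ)) a b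
    (Complex.ofReal_injective.comp hc) (Complex.ofReal_injective.comp hd), commute_diagonal_iff]
  have h1 : (Z * permUnitary π).1 * Matrix.diagonal (fun x => (c (a x) : ℂ)) *
      (Z * permUnitary π).1ᴴ = Z.1 * realDiag (fun x => c (a (π.symm x))) * Z.1ᴴ := by
    rw [realDiag, ← permMat_conj_diagonal π fun x => (c (a x) : ℂ)]
    simp only [Submonoid.coe_mul, permUnitary, Matrix.conjTranspose_mul, mul_assoc]
  rw [h1]
  simp only [ne_eq, Complex.ofReal_inj]

open scoped Matrix.Norms.Frobenius in
/-- Each stratum is a smooth embedded submanifold of the space of matrices. -/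
lemma isSmoothSubmanifold_stratum (K : ContingencyTable n m) :
    IsSmoothSubmanifold (entrySet (stratum e e' R S K)) := by
  obtain ⟨W₀, hW₀, h1W₀, hloc⟩ := exists_nhd_entries_eq_zero N
  obtain ⟨π, hπ⟩ := exists_perm_overlap_eq e e' K
  let a : Fin N → Fin r := fun x => (e.symm x).1
  let b : Fin N → Fin s := fun x => (e'.symm x).1
  -- A stratum depends only on the labellings, so any distinct values can stand in for the
  -- eigenvalues.
  let c : ∀ k, Fin k → ℝ := fun k i => ((i : ℕ) : ℝ)
  have hc : ∀ k, Function.Injective (c k) := fun k i j h =>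
    Fin.ext (Nat.cast_injective (R := ℝ) h)
  let d : Fin N → ℝ := fun x => c r (a (π.symm x))
  let ε : Fin N → ℝ := fun x => c s (b x)
  refine isSmoothSubmanifold_of_equations
    (E' := Matrix (Fin N) (Fin N) ℂ × Matrix (Fin N) (Fin N) ℂ)
    ?_
  rintro _ ⟨V, hV, rfl⟩
  have hV' := hV
  rw [stratum_eq_range e e' R S hπ] at hV'
  obtain ⟨⟨P, Q⟩, hPQ⟩ := hV'
  -- A and B carry V to the identity, and the set of aligned matrices to the one treated near 1 with
  -- d permuted by π.
  let A : U N := (S * blockHom e' P)⁻¹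
  let B : U N := R * blockHom e Q * (permUnitary π)⁻¹
  have hABV : A * V * B = 1 := by
    rw [← hPQ, orbitMap]
    simp only [A, B]
    group
  have hal : ∀ X : U N, IsAligned a b (S⁻¹ * X * R) ↔
      ∀ x y, ε x ≠ ε y → ((A * X * B).1 * realDiag d * (A * X * B).1ᴴ) x y = 0 := by
    intro X
    rw [← isAligned_mul_permUnitary_iff (hc r) (hc s) π,
      ← isAligned_mul_mul_iff e e' (Y := A * X * B * permUnitary π) (P := blockHom e' P)
        (Q := (blockHom e Q)⁻¹) ⟨P, rfl⟩ (inv_mem ⟨Q, rfl⟩)]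
    have : blockHom e' P * (A * X * B * permUnitary π) * (blockHom e Q)⁻¹ = S⁻¹ * X * R := by
      simp only [A, B]
      group
    rw [this]
  let Φ : (Fin N → Fin N → ℂ) →L[ℝ] Matrix (Fin N) (Fin N) ℂ := LinearMap.toContinuousLinearMap
    { toFun := fun X => A.1 * Matrix.of X * B.1
      map_add' := fun X Y => by
        rw [← Matrix.of_add_of, mul_add, add_mul]
      map_smul' := fun t X => by
        rw [← Matrix.smul_of, Matrix.mul_smul, Matrix.smul_mul, RingHom.id_apply] }
  have hΦ : ∀ X, Φ X = A.1 * Matrix.of X * B.1 := fun X => rfl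
  have hΦV : ∀ X : U N, Φ (fun y x => X.1 y x) = (A * X * B).1 := fun X => rfl
  have htr : Continuous fun X : Fin N → Fin N → ℂ => fun (i : Fin r) (j : Fin s) =>
      (alignProj a b (S.1ᴴ * Matrix.of X * R.1) (i, j)).trace := by
    refine continuous_pi fun i => continuous_pi fun j => ?_
    refine (continuous_trace_alignProj a b (i, j)).comp ?_
    exact (continuous_const.matrix_mul continuous_id).matrix_mul continuous_const
  let τ : Fin r → Fin s → ℂ := fun i j => (K.entry i j : ℂ)
  have hτ : ∀ X ∈ stratum e e' R S K, (fun (i : Fin r) (j : Fin s) =>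
      (alignProj a b (S.1ᴴ * Matrix.of (fun y x => X.1 y x) * R.1) (i, j)).trace) = τ := by
    intro X hX
    ext i j
    exact hX.2 i j
  -- The first condition makes the reduced equations sufficient for alignment. The second excludes
  -- the other strata, whose integer tables differ from K by at least 1 in some entry.
  refine ⟨Φ ⁻¹' W₀ ∩ {X | dist (fun (i : Fin r) (j : Fin s) =>
      (alignProj a b (S.1ᴴ * Matrix.of X * R.1) (i, j)).trace) τ < 1},
    (hW₀.preimage Φ.continuous).inter (isOpen_lt (htr.dist continuous_const) continuous_const),
    ⟨?_, ?_⟩, fun X => alignEq d ε (Φ X), alignSpace d ε, (contDiff_alignEq d ε).comp Φ.contDiff,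
    fun q => alignEq_mem d ε _, fun t ht => ?_, ?_⟩
  · rw [Set.mem_preimage, hΦV, hABV]
    exact h1W₀
  · rw [Set.mem_ofPred_eq, hτ V hV, dist_self]
    exact one_pos
  · obtain ⟨w, hw⟩ := exists_hasDerivAt_alignEq d ε ht
    refine ⟨fun y x => (A.1ᴴ * w * B.1ᴴ) y x, ?_⟩
    have h1 : Φ (fun y x => (A.1ᴴ * w * B.1ᴴ) y x) = w := by
      change A.1 * (A.1ᴴ * w * B.1ᴴ) * B.1 = w
      simp only [mul_assoc, coe_mul_conjTranspose_mul, conjTranspose_mul_coe, mul_one]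
    have h2 : Φ (fun y x => V.1 y x) = 1 := by rw [hΦV, hABV]; rfl
    refine hw.congr_of_eventuallyEq (Filter.Eventually.of_forall fun t => ?_)
    simp only [map_add, map_smul, h1, h2]
  · ext q
    constructor
    · rintro ⟨⟨X, hX, rfl⟩, hq⟩
      refine ⟨hq, ?_⟩
      change alignEq d ε (Φ (fun y x => X.1 y x)) = 0
      rw [hΦV, alignEq, conjTranspose_mul_coe, sub_self]
      refine Prod.ext rfl ?_
      ext x y
      change offMask d ε _ x y = 0
      rw [offMask_apply]
      split_ifs with h
      · rfl
      · exact (hal X).1 hX.1 x y fun h2 => h (Or.inr h2)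
    · rintro ⟨hq, h0⟩
      refine ⟨?_, hq⟩
      have h1 : (Φ q)ᴴ * Φ q = 1 := sub_eq_zero.1 (congrArg Prod.fst h0)
      let Z : U N := ⟨Φ q, Matrix.mem_unitaryGroup_iff'.2 h1⟩
      let X : U N := A⁻¹ * Z * B⁻¹
      have hXZ : A * X * B = Z := by simp only [X]; group
      have hXq : X.1 = Matrix.of q := by
        change A.1ᴴ * (A.1 * Matrix.of q * B.1) * B.1ᴴ = _
        simp only [mul_assoc, conjTranspose_mul_coe_mul, coe_mul_conjTranspose, mul_one]
      have hXal : IsAligned a b (S⁻¹ * X * R) := by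
        rw [hal, hXZ]
        refine hloc d ε Z hq.1 fun x y hd hε => ?_
        have h2 := congrFun (congrFun (congrArg Prod.snd h0) x) y
        simpa [alignEq, offMask_apply, hd, hε] using h2
      obtain ⟨K', hK'⟩ := hXal.exists_table
      refine ⟨X, ⟨hXal, fun i j => ?_⟩, congrArg (fun M y x => M y x) hXq⟩
      have h3 : dist ((K'.entry i j : ℕ) : ℂ) (K.entry i j : ℂ) < 1 := by
        refine lt_of_le_of_lt ?_ hq.2
        refine le_trans ?_ (dist_le_pi_dist _ _ i)
        refine le_trans ?_ (dist_le_pi_dist _ _ j)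
        rw [← hXq, ← hK' i j]
        rfl
      have h4 : (K'.entry i j : ℤ) = K.entry i j := by
        rw [← sub_eq_zero, ← Int.abs_lt_one_iff]
        have h5 : ((K'.entry i j : ℕ) : ℂ) - K.entry i j =
          (((K'.entry i j : ℤ) - K.entry i j : ℤ) : ℂ) := by push_cast; rfl
        rw [Complex.dist_eq, h5, Complex.norm_intCast] at h3
        exact_mod_cast h3
      exact (hK' i j).trans (by exact_mod_cast h4)

end Smooth

end

end QuantumLandscape

/-! ### The classification theorem -/

open QuantumLandscape in
theorem theorem2 {N r s : ℕ} (n : Fin r → ℕ) (m : Fin s → ℕ)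
    (hn : ∀ i, 0 < n i) (hm : ∀ j, 0 < m j)
    (lam : Fin r → ℝ) (eps : Fin s → ℝ) (hlam : StrictAnti lam) (heps : StrictAnti eps)
    (e : (Σ i, Fin (n i)) ≃ Fin N) (e' : (Σ j, Fin (m j)) ≃ Fin N)
    (R S : U N) (ρ θ : Matrix (Fin N) (Fin N) ℂ)
    (hρ : ρ = R.1 * blockScalar e lam * R.1.conjTranspose)
    (hθ : θ = S.1 * blockScalar e' eps * S.1.conjTranspose) :
    ∃ crit : ContingencyTable n m ≃ criticalSubmanifolds ρ θ,
      ∀ K : ContingencyTable n m,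
        IsSmoothSubmanifold (entrySet (crit K).1) ∧
        (∀ V ∈ (crit K).1, landscape ρ θ V.1 = ∑ i, ∑ j, (K.entry i j : ℝ) * lam i * eps j) ∧
        (∃ π : Equiv.Perm (Fin N), overlap e e' π = K.entry) ∧
        ∀ π : Equiv.Perm (Fin N), overlap e e' π = K.entry →
          (crit K).1 = {V : U N | ∃ (P : UProd m) (Q : UProd n),
            V.1 = S.1 * (blockMatrix e' P * permMat π * blockMatrix e Q) * R.1.conjTranspose} ∧
          ∃ (f : (Σ p : K.Support, Fin (K.entry p.1.1 p.1.2)) ≃ Fin N)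
            (φ : K.UK →* UProd m × UProd n),
            (∀ x, (e.symm (f x)).1 = x.1.1.1 ∧ (e'.symm (π (f x))).1 = x.1.1.2) ∧
            Continuous φ ∧ Function.Injective φ ∧
            (∀ W : K.UK, blockMatrix e (φ W).2 = blockMatrix f W ∧
              blockMatrix e' (φ W).1 = permMat π * blockMatrix f W * (permMat π).conjTranspose) ∧
            ∃ h : ((UProd m × UProd n) ⧸ φ.range) ≃ₜ (crit K).1,
              ∀ (P : UProd m) (Q : UProd n),
                (h (QuotientGroup.mk (P, Q))).1.1 =
                  S.1 * (blockMatrix e' P * permMat π * (blockMatrix e Q).conjTranspose) *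
                    R.1.conjTranspose := by
  subst hρ hθ
  obtain ⟨crit, hcrit⟩ := exists_equiv_criticalSubmanifolds e e' R S
    (mem_criticalSet_iff e e' R S hlam.injective heps.injective)
  refine ⟨crit, fun K => ?_⟩
  rw [hcrit]
  refine ⟨isSmoothSubmanifold_stratum e e' R S K,
    fun V hV => landscape_eq_of_mem_stratum e e' R S lam eps hV,
    exists_perm_overlap_eq e e' K, fun π hπ => ?_⟩
  have hrange := stratum_eq_range e e' R S hπ
  refine ⟨by rw [hrange, range_orbitMap], ?_⟩
  obtain ⟨f, φ, hf, hφc, hφi, hφ, horb⟩ := exists_stabilizer e e' R S π K hπ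
  refine ⟨f, φ, hf, hφc, hφi, hφ, ?_⟩
  obtain ⟨h, hh⟩ := exists_homeomorph_quotient φ.range
    (fun x => (⟨orbitMap e e' R S π x, hrange ▸ ⟨x, rfl⟩⟩ : stratum e e' R S K))
    ((continuous_orbitMap e e' R S π).subtype_mk _)
    (fun x y => Subtype.ext_iff.trans (horb x y))
    (by
      rintro ⟨V, hV⟩
      obtain ⟨x, hx⟩ := hrange ▸ hV
      exact ⟨x, Subtype.ext hx⟩)
  exact ⟨h, fun P Q => by rw [hh]; exact coe_orbitMap e e' R S π P Q⟩
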